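/- Let $d\ge 2$, let $\mathbb S=\mathbb R/\mathbb Z$ (embedded as the unit circle, oriented counterclockwise), and let $\sigma_d(t)=dt \pmod 1$. The distance of two points of $\mathbb S$ is the length of the shorter arc between them, and the length of a chord is the distance of its endpoints. An *all critical $d$-gon* is the convex hull of a fibre $\{x+i/d: 0\le i<d\}$ of $\sigma_d$. **MAC leaves.** Let $M=\overline{ab}$ with $a\ne b$ be a side of a polygon (or a single leaf, regarded as a polygon with two vertices) with finite vertex set $V\subset\mathbb S$ such that: $\sigma_d^n(V)=V$ for some $n\ge1$; the iterates of $\sigma_d$ preserve the circular order of $V$; any two polygons in the orbit of $V$ are equal or disjoint; and there is an all critical $d$-gon that every polygon of the orbit meets only in points of $\mathbb S$. Then $M$ is called a *major all critical (MAC) leaf*, with major $M$, if no leaf $\sigma_d^j(M)$ has length closer to $1/d$ than $M$ has. Name the endpoints so that the short arc subtended by $M$ runs counterclockwise from $a$ to $b$. **MAC laminations.** Attach an all critical $d$-gon to one of the endpoints of $M$: either use the vertices $a+i/d$ and the critical sectors $[a+\frac id,a+\frac{i+1}d)$, or use the vertices $b-i/d$ and the critical sectors $(b-\frac{i+1}d,b-\frac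 id]$, $0\le i<d$. Let $\tau_i$ be the inverse of $\sigma_d$ with values in the $i$-th sector, let $F_0$ be the set of all leaves $\sigma_d^j(M)$, $j\ge 0$, let $F_{n+1}=F_n\cup\bigcup_i\tau_i(F_n)$, and let the *MAC lamination* $\mathcal L(M)$ be the closure of $\bigcup_nF_n$. Its *central gap* $G$ is the closure of the component of $\overline{\mathbb D}\setminus(\mathbb S\cup\bigcup\mathcal L(M))$ that contains the centre of the disk. The *first return map* of $G$ is $\sigma_d^n$ for the least $n\ge1$ with $\sigma_d^n(G\cap\mathbb S)=G\cap\mathbb S$. A *co-root* is a point of $\mathbb S$ in the boundary of $G$, other than $a$ and $b$, that is fixed by the first return map. The *endcaps* are the $d$ closed arcs $[b+\frac id,a+\frac{i+1}d]$, $0\le i<d$, between consecutive members of the collection formed by $M$ and its siblings $M+\frac id$; an endcap is *adjacent to the major* if it contains $a$ or $b$. **Theorem (Co-root Theorem).** Let $M$ be a MAC leaf for $\sigma_d$, with a MAC lamination $\mathcal L(M)$ as above. Then the central gap returns to itself under some iterate of $\sigma_d$, so that its first return map is defined, and there are exactly $d-2$ co-roots. Each co-root lies in an endcap that is not adjacent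 to the major. Distinct co-roots lie in different endcaps, and their distance is greater than $1/d$. -/

import Mathlib

namespace MACLam

noncomputable section

/-! The circle is `UnitAddCircle = ℝ/ℤ`, with counterclockwise as its positive direction. -/

/-- The map `t ↦ d t (mod 1)`. -/
def sigma (d : ℕ) (x : UnitAddCircle) : UnitAddCircle := d • x

/-- The representative of `x` in `[0, 1)`. -/
def rep (x : UnitAddCircle) : ℝ := (AddCircle.equivIco (1 : ℝ) 0 x : ℝ)

/-- The length of the arc that runs counterclockwise from `p` to `q`. -/
def ccwLength (p q : UnitAddCircle) : ℝ := rep (q - p)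

/-- A point of the circle, as a point of the unit circle in the complex plane. -/
def pt (x : UnitAddCircle) : ℂ := (AddCircle.toCircle x : ℂ)

/-- The closed unit disk. -/
def disk : Set ℂ := Metric.closedBall 0 1

/-- The unit circle in the plane. -/
def circ : Set ℂ := Metric.sphere 0 1

/-- The chord of the disk with the given endpoints. A leaf is recorded by the ordered pair of its
endpoints, in both orders. -/
def chord (l : UnitAddCircle × UnitAddCircle) : Set ℂ := segment ℝ (pt l.1) (pt l.2)

/-- The filled polygon with the given vertices (a chord, if there are two of them). -/
def hull (V : Set UnitAddCircle) : Set ℂ := convexHull ℝ (pt '' V)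

/-- The length of a leaf is the length of the shorter arc that it subtends; this is the distance
of its endpoints in `ℝ/ℤ`. -/
def leafLength (l : UnitAddCircle × UnitAddCircle) : ℝ := dist l.1 l.2

/-- The image of a leaf. -/
def leafMap (d : ℕ) (l : UnitAddCircle × UnitAddCircle) : UnitAddCircle × UnitAddCircle :=
  (sigma d l.1, sigma d l.2)

/-- The vertices of the all critical `d`-gon that has `x` as one vertex: all points with the same
image as `x`. -/
def criticalPolygon (d : ℕ) (x : UnitAddCircle) : Set UnitAddCircle :=
  {y | sigma d y = sigma d x}

/-- `V` is the vertex set of a periodic polygon (or of a leaf, when it has two elements) whose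
images map forward preserving the circular order and without intersecting. -/
structure IsForwardInvariantPolygon (d : ℕ) (V : Set UnitAddCircle) : Prop where
  finite : V.Finite
  nontrivial : V.Nontrivial
  periodic : ∃ n : ℕ, 0 < n ∧ (sigma d)^[n] '' V = V
  order : ∀ j : ℕ, ∀ p ∈ V, ∀ q ∈ V, ∀ r ∈ V,
    sbtw p q r → sbtw ((sigma d)^[j] p) ((sigma d)^[j] q) ((sigma d)^[j] r)
  disjoint : ∀ i j : ℕ, (sigma d)^[i] '' V = (sigma d)^[j] '' V ∨
    Disjoint (hull ((sigma d)^[i] '' V)) (hull ((sigma d)^[j] '' V))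

/-- `a` and `b` are the endpoints of a side of the polygon with vertex set `V`. -/
def IsSide (V : Set UnitAddCircle) (a b : UnitAddCircle) : Prop :=
  a ∈ V ∧ b ∈ V ∧ a ≠ b ∧ ((∀ p ∈ V, ¬ sbtw a p b) ∨ ∀ p ∈ V, ¬ sbtw b p a)

/-- The orbit of `V` meets the all critical `d`-gon with vertex `x` only in vertices, that is,
only in points of the circle. -/
def IsCompatible (d : ℕ) (V : Set UnitAddCircle) (x : UnitAddCircle) : Prop :=
  ∀ j : ℕ, hull ((sigma d)^[j] '' V) ∩ hull (criticalPolygon d x) ⊆ circ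

/-- The leaf with endpoints `a`, `b` is a major all critical (MAC) leaf: a periodic leaf, or a side
of a periodic polygon, compatible with an all critical `d`-gon, and closest in its orbit to the
critical length `1 / d`. -/
def IsMACLeaf (d : ℕ) (a b : UnitAddCircle) : Prop :=
  (∃ V, IsForwardInvariantPolygon d V ∧ IsSide V a b ∧ ∃ x, IsCompatible d V x) ∧
  ∀ j : ℕ, |leafLength (a, b) - 1 / d| ≤ |leafLength ((leafMap d)^[j] (a, b)) - 1 / d|

/-- The branches of the inverse of `sigma d` for the all critical `d`-gon with vertex `v`, when
every critical sector owns its clockwise end: the values of branch `i` lie in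
`[v + i / d, v + (i + 1) / d)`. -/
def ccwBranch (d : ℕ) (v : UnitAddCircle) (i : Fin d) (t : UnitAddCircle) : UnitAddCircle :=
  v + ((((i : ℕ) + rep (t - sigma d v)) / d : ℝ) : UnitAddCircle)

/-- The same, when every critical sector owns its counterclockwise end: the values of branch `i`
lie in `(v - (i + 1) / d, v - i / d]`. -/
def cwBranch (d : ℕ) (v : UnitAddCircle) (i : Fin d) (t : UnitAddCircle) : UnitAddCircle :=
  v - ((((i : ℕ) + rep (sigma d v - t)) / d : ℝ) : UnitAddCircle)

theorem coe_rep (x : UnitAddCircle) : ((rep x : ℝ) : UnitAddCircle) = x :=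
  AddCircle.coe_equivIco

theorem nsmul_coe_div (d : ℕ) (i : Fin d) (s : ℝ) :
    d • ((((i : ℕ) + s) / d : ℝ) : UnitAddCircle) = ((s : ℝ) : UnitAddCircle) := by
  have hd : (d : ℝ) ≠ 0 := by
    have := i.pos
    positivity
  rw [← AddCircle.coe_nsmul, nsmul_eq_mul, mul_div_cancel₀ _ hd, AddCircle.coe_add]
  have h : (((i : ℕ) : ℝ) : UnitAddCircle) = 0 := by
    rw [AddCircle.coe_eq_zero_iff]
    exact ⟨(i : ℕ), by simp⟩
  rw [h, zero_add]

theorem sigma_ccwBranch (d : ℕ) (v : UnitAddCircle) (i : Fin d) (t : UnitAddCircle) :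
    sigma d (ccwBranch d v i t) = t := by
  unfold ccwBranch
  simp only [sigma, nsmul_add, nsmul_coe_div, coe_rep]
  abel

theorem sigma_cwBranch (d : ℕ) (v : UnitAddCircle) (i : Fin d) (t : UnitAddCircle) :
    sigma d (cwBranch d v i t) = t := by
  unfold cwBranch
  simp only [sigma, nsmul_sub, nsmul_coe_div, coe_rep]
  abel

/-- The `n`-th stage of the pullback, under the branches `τ`, of the orbit of the leaf with
endpoints `a`, `b`. -/
def pullbackStage (d : ℕ) (a b : UnitAddCircle) (τ : Fin d → UnitAddCircle → UnitAddCircle) :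
    ℕ → Set (UnitAddCircle × UnitAddCircle)
  | 0 => {l | ∃ j : ℕ, l = (leafMap d)^[j] (a, b) ∨ l = (leafMap d)^[j] (b, a)}
  | n + 1 => pullbackStage d a b τ n ∪
      ⋃ i : Fin d, (fun l => (τ i l.1, τ i l.2)) '' pullbackStage d a b τ n

/-- The pullback lamination: the closure of the union of all stages of the pullback. -/
def pullbackLamination (d : ℕ) (a b : UnitAddCircle)
    (τ : Fin d → UnitAddCircle → UnitAddCircle) : Set (UnitAddCircle × UnitAddCircle) :=
  closure (⋃ n : ℕ, pullbackStage d a b τ n)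

/-- The union of the circle and of all the leaves. -/
def body (L : Set (UnitAddCircle × UnitAddCircle)) : Set ℂ := circ ∪ ⋃ l ∈ L, chord l

/-- The central gap: the closure of the component of the complement of the leaves in the disk that
contains the centre of the disk. -/
def centralGap (L : Set (UnitAddCircle × UnitAddCircle)) : Set ℂ :=
  closure (connectedComponentIn (disk \ body L) 0)

/-- The points of the circle that belong to a gap. -/
def trace (G : Set ℂ) : Set UnitAddCircle := {x | pt x ∈ G}

/-- `n` is the first return time of the gap `G`. A gap is mapped by mapping its points on the
circle. The first return map of `G` is then the `n`-th iterate of `sigma d`. -/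
def IsFirstReturnTime (d : ℕ) (G : Set ℂ) (n : ℕ) : Prop :=
  IsLeast {k : ℕ | 0 < k ∧ (sigma d)^[k] '' trace G = trace G} n

/-- The co-roots: the points of the circle on the boundary of the gap `G`, other than the endpoints
`a`, `b` of the major, that the first return map of `G` fixes. -/
def coRoots (d : ℕ) (a b : UnitAddCircle) (G : Set ℂ) : Set UnitAddCircle :=
  {x | pt x ∈ frontier G ∧ x ≠ a ∧ x ≠ b ∧
    ∃ n, IsFirstReturnTime d G n ∧ (sigma d)^[n] x = x}

/-- The `i`-th endcap of the leaf with endpoints `a`, `b` and its siblings, the translates of the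
leaf by multiples of `1 / d`: the arc from `b + i / d` counterclockwise to `a + (i + 1) / d`. -/
def endcap (d : ℕ) (a b : UnitAddCircle) (i : Fin d) : Set UnitAddCircle :=
  Set.cIcc (b + (((i : ℕ) / d : ℝ) : UnitAddCircle))
    (a + ((((i : ℕ) + 1) / d : ℝ) : UnitAddCircle))

end

end MACLam

namespace MACLam

/-! ### Representatives and the circular order -/

/-! Write `l` for the length of the major. Each polygon of the orbit lies in one closed sector of
the compatible critical `d`-gon, so all orbit leaves are shorter than `1/d`, and being closest to
`1/d` means being longest. Comparing the major with its image gives `1 - d l ≤ l`. An orbit leaf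
shorter than `1 - d l` would have a preimage in the orbit `d` times shorter (`dist_sigma_eq`), so
all orbit leaves have length in `[1 - d l, l]`. The endcaps have length `(1 - d l)/d`, too short to
hold one, and no orbit leaf crosses a sibling of the major; hence every orbit leaf lies under a
sibling (`IsMACLeaf.isMajor`). Consequently no pullback leaf enters or leaves the arc under the
image of the major, every pullback leaf is at most `l` long, and the points of the central gap are
those of `uncut d a b a`.

Let `n` be the period of `a`. The first step of `sigma d` takes the central gap `d`-to-one onto the
gap behind the image of the major. From then on, until time `n`, the gap lies under a single
sibling, where `sigma d` is injective. So the return map is the `n`-th iterate (`isLeast_return`),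
it has degree `d`, and it expands (`dist_return`). Expansion allows at most one fixed point in an
endcap. The first endcap has `b`, the last has `a`, and in each of the other `d - 2` an inverse
branch of the return map is a contraction, which supplies a fixed point (`exists_fixed`,
`bijOn_sectorIndex`).

For the distances, the inverse branch from the central gap to the gap behind the image of the major
preserves the circular order and takes each co-root to its image under `sigma d`
(`exists_return_branch`). So a co-root in a later sector also lies further along inside its sector,
and two co-roots are more than one sector apart. Going round the other way they are separated by the
first and last sectors, which contain no co-root. -/

theorem rep_coe (r : ℝ) : rep (r : UnitAddCircle) = Int.fract r := by
  have h : (r : UnitAddCircle) = (Int.fract r : ℝ) := by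
    rw [← sub_eq_zero, ← AddCircle.coe_sub, AddCircle.coe_eq_zero_iff]
    exact ⟨⌊r⌋, by simp [Int.self_sub_fract]⟩
  rw [h, rep, AddCircle.equivIco_coe_eq
    (⟨Int.fract_nonneg r, by simpa using Int.fract_lt_one r⟩ :
      Int.fract r ∈ Set.Ico (0 : ℝ) (0 + 1))]

theorem rep_coe_eq {r : ℝ} (h0 : 0 ≤ r) (h1 : r < 1) : rep (r : UnitAddCircle) = r := by
  rw [rep_coe, Int.fract_eq_self.2 ⟨h0, h1⟩]

theorem rep_coe_eq_add_one {r : ℝ} (h0 : -1 ≤ r) (h1 : r < 0) :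
    rep (r : UnitAddCircle) = r + 1 := by
  rw [rep_coe, Int.fract_eq_iff]
  exact ⟨by linarith, by linarith, -1, by push_cast; ring⟩

theorem rep_nonneg (x : UnitAddCircle) : 0 ≤ rep x := (AddCircle.equivIco (1 : ℝ) 0 x).2.1

theorem rep_lt_one (x : UnitAddCircle) : rep x < 1 := by
  simpa [rep] using (AddCircle.equivIco (1 : ℝ) 0 x).2.2

theorem rep_injective : Function.Injective rep := fun x y h => by
  rw [← coe_rep x, ← coe_rep y, h]

@[simp] theorem rep_zero : rep 0 = 0 := by
  simpa using rep_coe_eq (r := 0) le_rfl one_pos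

theorem rep_eq_zero {x : UnitAddCircle} : rep x = 0 ↔ x = 0 :=
  ⟨fun h => rep_injective (h.trans rep_zero.symm), fun h => h ▸ rep_zero⟩

theorem rep_sub_pos {x y : UnitAddCircle} : 0 < rep (x - y) ↔ x ≠ y := by
  rw [lt_iff_le_and_ne, and_iff_right (rep_nonneg _), ne_comm, Ne, rep_eq_zero, sub_eq_zero]

theorem add_coe_rep_sub (x y : UnitAddCircle) : x + ((rep (y - x) : ℝ) : UnitAddCircle) = y := by
  rw [coe_rep]; abel

/-- The difference of two points, measured from a base point. -/
theorem rep_sub_of_le {c x y : UnitAddCircle} (h : rep (x - c) ≤ rep (y - c)) :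
    rep (y - x) = rep (y - c) - rep (x - c) := by
  have : y - x = ((rep (y - c) - rep (x - c) : ℝ) : UnitAddCircle) := by
    rw [AddCircle.coe_sub, coe_rep, coe_rep]; abel
  rw [this, rep_coe_eq (by linarith) (by linarith [rep_lt_one (y - c), rep_nonneg (x - c)])]

theorem rep_sub_of_lt {c x y : UnitAddCircle} (h : rep (y - c) < rep (x - c)) :
    rep (y - x) = rep (y - c) - rep (x - c) + 1 := by
  have : y - x = ((rep (y - c) - rep (x - c) : ℝ) : UnitAddCircle) := by
    rw [AddCircle.coe_sub, coe_rep, coe_rep]; abel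
  rw [this, rep_coe_eq_add_one (by linarith [rep_lt_one (x - c), rep_nonneg (y - c)])
    (by linarith)]

theorem rep_sub_swap {x y : UnitAddCircle} (h : x ≠ y) : rep (y - x) = 1 - rep (x - y) := by
  have h1 : rep (y - y) < rep (x - y) := by simpa using rep_sub_pos.2 h
  rw [rep_sub_of_lt h1]; simp; ring

theorem sbtw_iff_rep {p x q : UnitAddCircle} :
    sbtw p x q ↔ 0 < rep (x - p) ∧ rep (x - p) < rep (q - p) := by
  rw [sbtw_iff_not_btw, btw_cyclic]
  -- The circular order measures `q - p` in `[0, 1)` but `x - p` in `(0, 1]`; the two conventions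
  -- differ only at `x = p`, where `0` is replaced by `1`.
  have h : btw p q x ↔ rep (q - p) ≤ (AddCircle.equivIoc (1 : ℝ) 0 (x - p) : ℝ) := Iff.rfl
  rw [h, not_le]
  by_cases hx : x = p
  · have h1 : (AddCircle.equivIoc (1 : ℝ) 0 (x - p) : ℝ) = 1 := by
      have h2 : x - p = ((1 : ℝ) : UnitAddCircle) := by
        rw [hx, sub_self, AddCircle.coe_period]
      rw [h2, AddCircle.equivIoc_coe_eq (⟨one_pos, by simp⟩ : (1 : ℝ) ∈ Set.Ioc (0 : ℝ) (0 + 1))]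
    rw [h1]
    exact ⟨fun h => absurd h (by linarith [rep_lt_one (q - p)]), fun h => absurd h.1 (by simp [hx])⟩
  · have h0 := rep_sub_pos.2 hx
    have h1 : (AddCircle.equivIoc (1 : ℝ) 0 (x - p) : ℝ) = rep (x - p) := by
      conv_lhs => rw [← coe_rep (x - p)]
      rw [AddCircle.equivIoc_coe_eq (⟨h0, by simpa using (rep_lt_one (x - p)).le⟩ :
        rep (x - p) ∈ Set.Ioc (0 : ℝ) (0 + 1))]
    rw [h1]
    exact ⟨fun h => ⟨h0, h⟩, fun h => h.2⟩

theorem mem_cIcc_iff_rep {p x q : UnitAddCircle} (h : p ≠ q) :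
    x ∈ Set.cIcc p q ↔ rep (x - p) ≤ rep (q - p) := by
  rw [Set.mem_cIcc, btw_iff_not_sbtw, sbtw_cyclic, sbtw_iff_rep, not_and, not_lt]
  exact ⟨fun H => H (rep_sub_pos.2 h.symm), fun H _ => H⟩

/-! ### Distances on the circle and the map `sigma` -/

theorem norm_coe_of_abs_le {r : ℝ} (h : |r| ≤ 1 / 2) : ‖(r : UnitAddCircle)‖ = |r| := by
  rw [AddCircle.norm_coe_eq_abs_iff _ one_ne_zero]; simpa using h

theorem norm_coe_of_half_le {r : ℝ} (h : 1 / 2 ≤ |r|) (h' : |r| ≤ 1) :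
    ‖(r : UnitAddCircle)‖ = 1 - |r| := by
  wlog hr : 0 ≤ r generalizing r
  · have := this (r := -r) (by simpa using h) (by simpa using h') (by linarith)
    simpa using this
  rw [abs_of_nonneg hr] at *
  have h1 : (r : UnitAddCircle) = ((r - 1 : ℝ) : UnitAddCircle) := by
    rw [AddCircle.coe_sub, AddCircle.coe_period, sub_zero]
  rw [h1, norm_coe_of_abs_le, abs_of_nonpos] <;>
    [linarith; linarith; (rw [abs_le]; constructor <;> linarith)]

theorem exists_coe_eq_sub (p q : UnitAddCircle) :
    ∃ u : ℝ, q = p + (u : UnitAddCircle) ∧ |u| = dist p q ∧ |u| ≤ 1 / 2 := by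
  have key : ∀ u : ℝ, q = p + (u : UnitAddCircle) → |u| ≤ 1 / 2 →
      ∃ u : ℝ, q = p + (u : UnitAddCircle) ∧ |u| = dist p q ∧ |u| ≤ 1 / 2 := fun u h h' =>
    ⟨u, h, by rw [dist_comm, dist_eq_norm, h, add_sub_cancel_left, norm_coe_of_abs_le h'], h'⟩
  have h0 := rep_nonneg (q - p)
  have h1 := rep_lt_one (q - p)
  rcases le_total (rep (q - p)) (1 / 2) with h | h
  · exact key (rep (q - p)) (add_coe_rep_sub p q).symm (by rwa [abs_of_nonneg h0])
  · refine key (rep (q - p) - 1) ?_ (by rw [abs_of_nonpos (by linarith)]; linarith)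
    rw [AddCircle.coe_sub, AddCircle.coe_period, sub_zero, add_coe_rep_sub]

theorem dist_eq_ccwLength {p q : UnitAddCircle} (h : ccwLength p q ≤ 1 / 2) :
    dist p q = ccwLength p q := by
  have h0 : |rep (q - p)| = ccwLength p q := abs_of_nonneg (rep_nonneg _)
  rw [dist_comm, dist_eq_norm, ← coe_rep (q - p), norm_coe_of_abs_le (by rwa [h0]), h0]

theorem sigma_add (d : ℕ) (x y : UnitAddCircle) : sigma d (x + y) = sigma d x + sigma d y :=
  nsmul_add _ _ _

theorem sigma_sub (d : ℕ) (x y : UnitAddCircle) : sigma d (x - y) = sigma d x - sigma d y :=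
  nsmul_sub _ _ _

theorem sigma_coe (d : ℕ) (r : ℝ) :
    sigma d (r : UnitAddCircle) = ((d * r : ℝ) : UnitAddCircle) := by
  rw [sigma, ← AddCircle.coe_nsmul, nsmul_eq_mul]

theorem rep_sigma (d : ℕ) (x : UnitAddCircle) : rep (sigma d x) = Int.fract (d * rep x) := by
  conv_lhs => rw [← coe_rep x]
  rw [sigma_coe, rep_coe]

theorem coe_int_eq_zero (k : ℤ) : ((k : ℝ) : UnitAddCircle) = 0 :=
  (AddCircle.coe_eq_zero_iff _).2 ⟨k, by simp⟩

theorem coe_eq_coe_iff {r s : ℝ} : (r : UnitAddCircle) = s ↔ ∃ k : ℤ, r = s + k := by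
  rw [← sub_eq_zero, ← AddCircle.coe_sub, AddCircle.coe_eq_zero_iff]
  constructor
  · rintro ⟨k, hk⟩; exact ⟨k, by simp at hk; linarith⟩
  · rintro ⟨k, hk⟩; exact ⟨k, by simp [hk]⟩

/-- Over distances at most `l`, points whose images are less than `1 - d * l` apart are
contracted by the inverse of `sigma d`. -/
theorem dist_sigma_eq {d : ℕ} {l : ℝ} (hl : d * l ≤ 1) {p q : UnitAddCircle} (h : dist p q ≤ l)
    (h' : dist (sigma d p) (sigma d q) < 1 - d * l) :
    dist (sigma d p) (sigma d q) = d * dist p q := by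
  obtain ⟨u, hu, hd, hu'⟩ := exists_coe_eq_sub p q
  have h1 : dist (sigma d p) (sigma d q) = ‖((d * u : ℝ) : UnitAddCircle)‖ := by
    rw [dist_comm, dist_eq_norm, ← sigma_sub, hu, add_sub_cancel_left, sigma_coe]
  have h2 : |d * u| = d * |u| := by rw [abs_mul, abs_of_nonneg (Nat.cast_nonneg d)]
  have h3 : (d : ℝ) * |u| ≤ d * l := by rw [hd]; gcongr
  rcases le_total |d * u| (1 / 2) with hh | hh
  · rw [h1, norm_coe_of_abs_le hh, h2, hd]
  · rw [h1, norm_coe_of_half_le hh (by linarith)] at h'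
    linarith

/-! ### Chords of the disk -/

theorem pt_coe_re (t : ℝ) : (pt (t : UnitAddCircle)).re = Real.cos (2 * Real.pi * t) := by
  rw [pt, AddCircle.toCircle_apply_mk, Circle.coe_exp, div_one, Complex.exp_ofReal_mul_I_re]

theorem pt_coe_im (t : ℝ) : (pt (t : UnitAddCircle)).im = Real.sin (2 * Real.pi * t) := by
  rw [pt, AddCircle.toCircle_apply_mk, Circle.coe_exp, div_one, Complex.exp_ofReal_mul_I_im]

theorem continuous_pt : Continuous pt :=
  continuous_subtype_val.comp AddCircle.continuous_toCircle

theorem norm_pt (x : UnitAddCircle) : ‖pt x‖ = 1 := Circle.norm_coe _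

/-- The component of `z` in the direction of the point of the circle at angle `m`. -/
noncomputable def proj (m : ℝ) (z : ℂ) : ℝ :=
  Real.cos (2 * Real.pi * m) * z.re + Real.sin (2 * Real.pi * m) * z.im

theorem proj_pt_add (m t : ℝ) : proj m (pt ((m + t : ℝ) : UnitAddCircle)) =
    Real.cos (2 * Real.pi * t) := by
  have h : 2 * Real.pi * t = 2 * Real.pi * (m + t) - 2 * Real.pi * m := by ring
  rw [proj, pt_coe_re, pt_coe_im, h, Real.cos_sub]; ring

theorem proj_combo (m : ℝ) (s t : ℝ) (z w : ℂ) :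
    proj m (s • z + t • w) = s * proj m z + t * proj m w := by
  simp [proj]; ring

/-- In coordinates rotated by the angle of `m`, the hypothesis puts `z` on the line of the chord,
and `‖z‖ ≤ 1` bounds the other coordinate `y` by half the length of the chord. -/
theorem mem_segment_of_proj_eq {m h : ℝ} (h0 : 0 ≤ h) (h1 : h ≤ 1 / 2) {z : ℂ} (hz : ‖z‖ ≤ 1)
    (hp : proj m z = Real.cos (2 * Real.pi * h)) :
    z ∈ segment ℝ (pt ((m - h : ℝ) : UnitAddCircle)) (pt ((m + h : ℝ) : UnitAddCircle)) := by
  set s := Real.sin (2 * Real.pi * h) with hs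
  set y := -Real.sin (2 * Real.pi * m) * z.re + Real.cos (2 * Real.pi * m) * z.im with hy
  have hpi := Real.pi_pos
  have hs0 : 0 ≤ s := Real.sin_nonneg_of_nonneg_of_le_pi (by positivity) (by nlinarith)
  have hcs := Real.sin_sq_add_cos_sq (2 * Real.pi * h)
  have hcm := Real.sin_sq_add_cos_sq (2 * Real.pi * m)
  have hz2 : z.re ^ 2 + z.im ^ 2 ≤ 1 := by
    have := Complex.sq_norm z
    rw [Complex.normSq_apply] at this
    nlinarith [norm_nonneg z]
  have hyp : y ^ 2 + proj m z ^ 2 = z.re ^ 2 + z.im ^ 2 := by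
    rw [hy, proj]
    linear_combination (z.re ^ 2 + z.im ^ 2) * hcm
  have hys : y ^ 2 ≤ s ^ 2 := by rw [hp] at hyp; nlinarith
  have habs : |y| ≤ s := abs_le_of_sq_le_sq hys hs0
  -- The relative position of `z` on the chord; for `s = 0` the chord is a single point and any `w`
  -- serves.
  obtain ⟨w, hw, hw1⟩ : ∃ w, y = s * w ∧ |w| ≤ 1 := by
    rcases hs0.eq_or_lt with h | h
    · exact ⟨0, by rw [← h] at habs ⊢; simpa using habs, by simp⟩
    · exact ⟨y / s, by field_simp, by rw [abs_div, abs_of_pos h, div_le_one h]; exact habs⟩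
  rw [abs_le] at hw1
  refine ⟨(1 - w) / 2, (1 + w) / 2, by linarith, by linarith, by ring, ?_⟩
  have e1 : 2 * Real.pi * (m - h) = 2 * Real.pi * m - 2 * Real.pi * h := by ring
  have e2 : 2 * Real.pi * (m + h) = 2 * Real.pi * m + 2 * Real.pi * h := by ring
  rw [proj] at hp
  apply Complex.ext
  · simp only [Complex.add_re, Complex.real_smul, Complex.mul_re, Complex.ofReal_re,
      Complex.ofReal_im, zero_mul, sub_zero, pt_coe_re, e1, e2, Real.cos_sub, Real.cos_add]
    rw [← hs]
    linear_combination (-Real.cos (2 * Real.pi * m)) * hp + Real.sin (2 * Real.pi * m) * hw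
      - Real.sin (2 * Real.pi * m) * hy + z.re * hcm
  · simp only [Complex.add_im, Complex.real_smul, Complex.mul_im, Complex.ofReal_re,
      Complex.ofReal_im, zero_mul, add_zero, pt_coe_im, e1, e2, Real.sin_sub, Real.sin_add]
    rw [← hs]
    linear_combination (-Real.sin (2 * Real.pi * m)) * hp - Real.cos (2 * Real.pi * m) * hw
      + Real.cos (2 * Real.pi * m) * hy + z.im * hcm

theorem cos_lt_cos_of_abs_lt {h t : ℝ} (ht : |t| < h) (h1 : h ≤ 1 / 2) :
    Real.cos (2 * Real.pi * h) < Real.cos (2 * Real.pi * t) := by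
  have hpi := Real.pi_pos
  have : Real.cos (2 * Real.pi * t) = Real.cos (2 * Real.pi * |t|) := by
    rw [← Real.cos_abs, abs_mul, abs_of_pos (by positivity : 0 < 2 * Real.pi)]
  rw [this]
  exact Real.cos_lt_cos_of_nonneg_of_le_pi (by positivity) (by nlinarith) (by gcongr)

theorem cos_lt_cos_of_lt_of_lt {h t : ℝ} (h0 : 0 ≤ h) (ht : h < t) (ht' : t < 1 - h) :
    Real.cos (2 * Real.pi * t) < Real.cos (2 * Real.pi * h) := by
  have h2 := cos_lt_cos_of_abs_lt (h := 1 / 2 - h) (t := t - 1 / 2)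
    (by rw [abs_lt]; constructor <;> linarith) (by linarith)
  have e1 : 2 * Real.pi * (1 / 2 - h) = Real.pi - 2 * Real.pi * h := by ring
  have e2 : 2 * Real.pi * (t - 1 / 2) = 2 * Real.pi * t - Real.pi := by ring
  rw [e1, e2, Real.cos_pi_sub, Real.cos_sub_pi] at h2
  linarith

/-- Half the length of the arc from `p` to `q`. -/
noncomputable def halfArc (p q : UnitAddCircle) : ℝ := rep (q - p) / 2

/-- The midpoint of the arc from `p` to `q`. -/
noncomputable def midArc (p q : UnitAddCircle) : ℝ := rep p + halfArc p q

theorem halfArc_nonneg (p q : UnitAddCircle) : 0 ≤ halfArc p q :=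
  div_nonneg (rep_nonneg _) zero_le_two

theorem halfArc_lt (p q : UnitAddCircle) : halfArc p q < 1 / 2 := by
  have := rep_lt_one (q - p); unfold halfArc; linarith

theorem coe_midArc_sub (p q : UnitAddCircle) :
    ((midArc p q - halfArc p q : ℝ) : UnitAddCircle) = p := by
  rw [midArc, add_sub_cancel_right, coe_rep]

theorem coe_midArc_add (p q x : UnitAddCircle) :
    ((midArc p q + (rep (x - p) - halfArc p q) : ℝ) : UnitAddCircle) = x := by
  rw [midArc, add_add_sub_cancel, AddCircle.coe_add, coe_rep, add_coe_rep_sub]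

theorem coe_midArc_add_halfArc (p q : UnitAddCircle) :
    ((midArc p q + halfArc p q : ℝ) : UnitAddCircle) = q := by
  have := coe_midArc_add p q q
  rwa [show rep (q - p) - halfArc p q = halfArc p q by unfold halfArc; ring] at this

theorem proj_midArc (p q x : UnitAddCircle) : proj (midArc p q) (pt x) =
    Real.cos (2 * Real.pi * (rep (x - p) - halfArc p q)) := by
  conv_lhs => rw [← coe_midArc_add p q x, proj_pt_add]

theorem mem_chord_of_proj {p q : UnitAddCircle} {z : ℂ} (hz : ‖z‖ ≤ 1)
    (hp : proj (midArc p q) z = Real.cos (2 * Real.pi * halfArc p q)) :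
    z ∈ segment ℝ (pt p) (pt q) := by
  have := mem_segment_of_proj_eq (halfArc_nonneg p q) (halfArc_lt p q).le hz hp
  rwa [coe_midArc_sub, coe_midArc_add_halfArc] at this

theorem proj_left (p q : UnitAddCircle) :
    proj (midArc p q) (pt p) = Real.cos (2 * Real.pi * halfArc p q) := by
  rw [proj_midArc, sub_self, rep_zero, zero_sub, mul_neg, Real.cos_neg]

theorem proj_right (p q : UnitAddCircle) :
    proj (midArc p q) (pt q) = Real.cos (2 * Real.pi * halfArc p q) := by
  rw [proj_midArc, show rep (q - p) - halfArc p q = halfArc p q by unfold halfArc; ring]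

theorem lt_proj_of_lt {p q x : UnitAddCircle} (h0 : 0 < rep (x - p))
    (h1 : rep (x - p) < rep (q - p)) :
    Real.cos (2 * Real.pi * halfArc p q) < proj (midArc p q) (pt x) := by
  rw [proj_midArc]
  exact cos_lt_cos_of_abs_lt (by unfold halfArc; rw [abs_lt]; constructor <;> linarith)
    (halfArc_lt p q).le

theorem proj_lt_of_lt {p q x : UnitAddCircle} (h1 : rep (q - p) < rep (x - p)) :
    proj (midArc p q) (pt x) < Real.cos (2 * Real.pi * halfArc p q) := by
  rw [proj_midArc]
  exact cos_lt_cos_of_lt_of_lt (halfArc_nonneg p q) (by unfold halfArc; linarith)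
    (by have := rep_lt_one (x - p); linarith)

theorem lt_proj_iff {p q x : UnitAddCircle} :
    Real.cos (2 * Real.pi * halfArc p q) < proj (midArc p q) (pt x) ↔ sbtw p x q := by
  rw [sbtw_iff_rep]
  refine ⟨fun h => ?_, fun h => lt_proj_of_lt h.1 h.2⟩
  by_contra hc
  rcases lt_trichotomy (rep (q - p)) (rep (x - p)) with h1 | h1 | h1
  · exact absurd h (proj_lt_of_lt h1).not_gt
  · rw [proj_midArc, ← h1, show rep (q - p) - halfArc p q = halfArc p q by unfold halfArc; ring]
      at h
    exact lt_irrefl _ h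
  · have : rep (x - p) = 0 := le_antisymm (not_lt.1 fun h0 => hc ⟨h0, h1⟩) (rep_nonneg _)
    rw [rep_eq_zero, sub_eq_zero] at this
    rw [this, proj_left] at h
    exact lt_irrefl _ h

/-- Chords with interlacing endpoints meet in the open disk. -/
theorem exists_mem_segment_of_cross {u v p q : UnitAddCircle} (h0 : 0 < rep (p - u))
    (h1 : rep (p - u) < rep (v - u)) (h2 : rep (v - u) < rep (q - u)) :
    ∃ z, z ∈ segment ℝ (pt u) (pt v) ∧ z ∈ segment ℝ (pt p) (pt q) ∧ ‖z‖ < 1 := by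
  set A := proj (midArc u v) (pt p) with hA
  set B := proj (midArc u v) (pt q) with hB
  set c := Real.cos (2 * Real.pi * halfArc u v) with hc
  have hA' : c < A := lt_proj_of_lt h0 h1
  have hB' : B < c := proj_lt_of_lt h2
  have hs : 0 < (c - B) / (A - B) := div_pos (by linarith) (by linarith)
  have ht : 0 < (A - c) / (A - B) := div_pos (by linarith) (by linarith)
  have hAB : A - B ≠ 0 := by linarith
  have hst : (c - B) / (A - B) + (A - c) / (A - B) = 1 := by field_simp; ring
  have hne : pt p ≠ pt q := fun h => by rw [hA, h, ← hB] at hA'; linarith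
  have hz : ‖((c - B) / (A - B)) • pt p + ((A - c) / (A - B)) • pt q‖ < 1 :=
    norm_combo_lt_of_ne (norm_pt p).le (norm_pt q).le hne hs ht hst
  refine ⟨_, mem_chord_of_proj hz.le ?_, ⟨_, _, hs.le, ht.le, hst, rfl⟩, hz⟩
  rw [proj_combo, ← hA, ← hB]
  field_simp
  ring

/-! ### The central gap -/

/-- The affine functional that vanishes on the chord from `p` to `q`, positive on the side of the
shorter arc. -/
noncomputable def chordForm (p q : UnitAddCircle) (z : ℂ) : ℝ :=
  ((pt p).re + (pt q).re) * z.re + ((pt p).im + (pt q).im) * z.im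
    - (1 + (pt p).re * (pt q).re + (pt p).im * (pt q).im)

/-- The factor `2 * cos` makes the form independent of the order of the endpoints: swapping them
reverses the direction of the midpoint and the sign of the cosine together. The polynomial form in
the definition makes it continuous in the leaf, so that conditions pass to the closure of a family.
-/
theorem chordForm_eq (p q : UnitAddCircle) (z : ℂ) : chordForm p q z =
    2 * Real.cos (2 * Real.pi * halfArc p q) *
      (proj (midArc p q) z - Real.cos (2 * Real.pi * halfArc p q)) := by
  have hp := coe_midArc_sub p q
  have hq := coe_midArc_add_halfArc p q
  set m := midArc p q
  set h := halfArc p q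
  have e1 : 2 * Real.pi * (m - h) = 2 * Real.pi * m - 2 * Real.pi * h := by ring
  have e2 : 2 * Real.pi * (m + h) = 2 * Real.pi * m + 2 * Real.pi * h := by ring
  have hcs := Real.sin_sq_add_cos_sq (2 * Real.pi * h)
  have hcm := Real.sin_sq_add_cos_sq (2 * Real.pi * m)
  rw [chordForm, proj, ← hp, ← hq, pt_coe_re, pt_coe_re, pt_coe_im, pt_coe_im, e1, e2,
    Real.cos_sub, Real.cos_add, Real.sin_sub, Real.sin_add]
  linear_combination (Real.sin (2 * Real.pi * h) ^ 2 - Real.cos (2 * Real.pi * h) ^ 2) * hcm + hcs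

theorem chordForm_combo (p q : UnitAddCircle) {s t : ℝ} (hst : s + t = 1) (z w : ℂ) :
    chordForm p q (s • z + t • w) = s * chordForm p q z + t * chordForm p q w := by
  simp [chordForm]
  linear_combination (1 + (pt p).re * (pt q).re + (pt p).im * (pt q).im) * hst

theorem continuous_chordForm (p q : UnitAddCircle) : Continuous (chordForm p q) := by
  unfold chordForm; fun_prop

theorem cos_halfArc_ne_zero {p q : UnitAddCircle} (h : dist p q < 1 / 2) :
    Real.cos (2 * Real.pi * halfArc p q) ≠ 0 := by
  have hpi := Real.pi_pos
  have h0 := halfArc_nonneg p q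
  have h1 := halfArc_lt p q
  rcases lt_trichotomy (halfArc p q) (1 / 4) with hh | hh | hh
  · exact (Real.cos_pos_of_mem_Ioo ⟨by nlinarith, by nlinarith⟩).ne'
  · have : ccwLength p q = 1 / 2 := by unfold halfArc at hh; unfold ccwLength; linarith
    rw [dist_eq_ccwLength this.le, this] at h
    exact absurd h (lt_irrefl _)
  · exact (Real.cos_neg_of_pi_div_two_lt_of_lt (by nlinarith) (by nlinarith)).ne

theorem chordForm_zero_neg {p q : UnitAddCircle} (h : dist p q < 1 / 2) : chordForm p q 0 < 0 := by
  have : 0 < Real.cos (2 * Real.pi * halfArc p q) ^ 2 := by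
    have := cos_halfArc_ne_zero h; positivity
  rw [chordForm_eq]; simp [proj]; nlinarith

theorem chordForm_eq_zero_of_mem {p q : UnitAddCircle} {z : ℂ} (hz : z ∈ chord (p, q)) :
    chordForm p q z = 0 := by
  obtain ⟨s, t, -, -, hst, rfl⟩ := hz
  rw [chordForm_combo _ _ hst, chordForm_eq, chordForm_eq, proj_left, proj_right]; ring

theorem mem_chord_of_chordForm {p q : UnitAddCircle} (h : dist p q < 1 / 2) {z : ℂ}
    (hz : ‖z‖ ≤ 1) (h0 : chordForm p q z = 0) : z ∈ chord (p, q) := by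
  apply mem_chord_of_proj hz
  rw [chordForm_eq] at h0
  have := cos_halfArc_ne_zero h
  have h2 := (mul_eq_zero.1 h0).resolve_left (by positivity)
  linarith

theorem chordForm_pt_pos_iff {p q x : UnitAddCircle} (h : ccwLength p q < 1 / 2) :
    0 < chordForm p q (pt x) ↔ sbtw p x q := by
  have hpi := Real.pi_pos
  have h0 := halfArc_nonneg p q
  have h1 : halfArc p q < 1 / 4 := by unfold ccwLength at h; unfold halfArc; linarith
  have : 0 < Real.cos (2 * Real.pi * halfArc p q) :=
    Real.cos_pos_of_mem_Ioo ⟨by nlinarith, by nlinarith⟩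
  rw [← lt_proj_iff, chordForm_eq, mul_pos_iff_of_pos_left (by positivity), sub_pos]

theorem chordForm_comm (p q : UnitAddCircle) (z : ℂ) : chordForm p q z = chordForm q p z := by
  simp only [chordForm]; ring

/-- The right side is convex and avoids all leaves. Conversely each form is negative at the centre
and vanishes in the disk only on its chord, so it cannot change sign on a connected set that misses
the chord. -/
theorem connectedComponentIn_diff_body {Λ : Set (UnitAddCircle × UnitAddCircle)}
    (hΛ : ∀ l ∈ Λ, dist l.1 l.2 < 1 / 2) :
    connectedComponentIn (disk \ body Λ) 0 =
      {z | ‖z‖ < 1 ∧ ∀ l ∈ Λ, chordForm l.1 l.2 z < 0} := by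
  set C : Set ℂ := {z | ‖z‖ < 1 ∧ ∀ l ∈ Λ, chordForm l.1 l.2 z < 0} with hC
  have h0 : (0 : ℂ) ∈ C := ⟨by simp, fun l hl => chordForm_zero_neg (hΛ l hl)⟩
  have hsub : C ⊆ disk \ body Λ := by
    rintro z ⟨hz, hzl⟩
    refine ⟨by simpa [disk] using hz.le, ?_⟩
    rintro (h | h)
    · simp [circ] at h; linarith
    · obtain ⟨l, hl, hm⟩ := Set.mem_iUnion₂.1 h
      exact (hzl l hl).ne (chordForm_eq_zero_of_mem hm)
  apply Set.Subset.antisymm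
  · intro z hz
    have hzD := connectedComponentIn_subset _ _ hz
    refine ⟨?_, fun l hl => ?_⟩
    · have h1 : ‖z‖ ≤ 1 := by simpa [disk] using hzD.1
      exact lt_of_le_of_ne h1 fun h => hzD.2 (Or.inl (by simpa [circ] using h))
    · by_contra hc
      obtain ⟨w, hw, hw0⟩ := isPreconnected_connectedComponentIn.intermediate_value
        (mem_connectedComponentIn (hsub h0)) hz (continuous_chordForm l.1 l.2).continuousOn
        ⟨(chordForm_zero_neg (hΛ l hl)).le, not_lt.1 hc⟩
      have hwD := connectedComponentIn_subset _ _ hw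
      exact hwD.2 (Or.inr (Set.mem_iUnion₂.2
        ⟨l, hl, mem_chord_of_chordForm (hΛ l hl) (by simpa [disk] using hwD.1) hw0⟩))
  · refine IsPreconnected.subset_connectedComponentIn (Convex.isPreconnected ?_) h0 hsub
    rintro z ⟨hz, hzl⟩ w ⟨hw, hwl⟩ s t hs ht hst
    refine ⟨?_, fun l hl => ?_⟩
    · have := convex_ball (0 : ℂ) 1 (by simpa using hz) (by simpa using hw) hs ht hst
      simpa using this
    · rw [chordForm_combo _ _ hst]
      have h1 := hzl l hl
      have h2 := hwl l hl
      rcases hs.eq_or_lt with rfl | hs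
      · have : t = 1 := by linarith
        rw [this]; linarith
      · nlinarith

/-- The points of the circle on the central gap of a family of short leaves: those that are not
cut off by a leaf. -/
theorem trace_centralGap {F : Set (UnitAddCircle × UnitAddCircle)}
    (hsymm : ∀ p q, (p, q) ∈ F → (q, p) ∈ F) {c : ℝ} (hc : c < 1 / 2)
    (hF : ∀ l ∈ F, dist l.1 l.2 ≤ c) :
    trace (centralGap (closure F)) =
      {x | ∀ p q, (p, q) ∈ F → ccwLength p q < 1 / 2 → ¬ sbtw p x q} := by
  have hΛ : ∀ l ∈ closure F, dist l.1 l.2 < 1 / 2 := fun l hl => by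
    have hcl : IsClosed {l : UnitAddCircle × UnitAddCircle | dist l.1 l.2 ≤ c} :=
      isClosed_le (by fun_prop) continuous_const
    have h : l ∈ {l : UnitAddCircle × UnitAddCircle | dist l.1 l.2 ≤ c} :=
      closure_minimal hF hcl hl
    exact lt_of_le_of_lt h hc
  ext x
  have hx1 := norm_pt x
  change pt x ∈ closure (connectedComponentIn (disk \ body (closure F)) 0) ↔ _
  rw [connectedComponentIn_diff_body hΛ]
  have key : (∀ p q, (p, q) ∈ F → ccwLength p q < 1 / 2 → ¬ sbtw p x q) ↔
      ∀ l ∈ F, chordForm l.1 l.2 (pt x) ≤ 0 := by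
    constructor
    · rintro H ⟨p, q⟩ hl
      by_contra hpos
      rw [not_le] at hpos
      by_cases hpq : p = q
      · subst hpq
        have h2 : ccwLength p p < 1 / 2 := by simp [ccwLength]
        exact sbtw_irrefl_left_right ((chordForm_pt_pos_iff h2).1 hpos)
      have hd := hΛ _ (subset_closure hl)
      rcases lt_trichotomy (ccwLength p q) (1 / 2) with h | h | h
      · exact H p q hl h ((chordForm_pt_pos_iff h).1 hpos)
      · simp only [dist_eq_ccwLength h.le, h] at hd
        exact lt_irrefl _ hd
      · have h' : ccwLength q p < 1 / 2 := by
          unfold ccwLength at h ⊢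
          rw [rep_sub_swap (Ne.symm hpq)]; linarith
        have hpos' : 0 < chordForm q p (pt x) := by rw [chordForm_comm]; exact hpos
        exact H q p (hsymm _ _ hl) h' ((chordForm_pt_pos_iff h').1 hpos')
    · intro H p q hl h hs
      exact absurd ((chordForm_pt_pos_iff h).2 hs) (H _ hl).not_gt
  change _ ↔ (∀ p q, (p, q) ∈ F → ccwLength p q < 1 / 2 → ¬ sbtw p x q)
  rw [key]
  constructor
  · intro h l hl
    have : closure {z | ‖z‖ < 1 ∧ ∀ l ∈ closure F, chordForm l.1 l.2 z < 0} ⊆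
        {z | chordForm l.1 l.2 z ≤ 0} :=
      closure_minimal (fun z hz => (hz.2 l (subset_closure hl)).le)
        (isClosed_le (continuous_chordForm _ _) continuous_const)
    exact this h
  · intro h
    have hcl : ∀ l ∈ closure F, chordForm l.1 l.2 (pt x) ≤ 0 := by
      have h2 : IsClosed {l : UnitAddCircle × UnitAddCircle | chordForm l.1 l.2 (pt x) ≤ 0} := by
        refine isClosed_le ?_ continuous_const
        have := continuous_pt
        unfold chordForm
        fun_prop
      exact fun l hl => closure_minimal (fun l hl => h l hl) h2 hl
    -- The point is approached along its radius: there each form is a convex combination of a value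
    -- `≤ 0` at `pt x` and a value `< 0` at the centre.
    have htend : Filter.Tendsto (fun s : ℝ => s • pt x) (nhdsWithin 1 (Set.Iio 1))
        (nhds (pt x)) := by
      have h3 : Continuous fun s : ℝ => s • pt x := by fun_prop
      have h4 := h3.tendsto 1
      rw [one_smul] at h4
      exact h4.mono_left nhdsWithin_le_nhds
    refine mem_closure_of_tendsto htend ?_
    filter_upwards [Ioo_mem_nhdsLT (show (0 : ℝ) < 1 by norm_num)] with s hs
    refine ⟨by rw [norm_smul, hx1, mul_one, Real.norm_of_nonneg hs.1.le]; exact hs.2,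
      fun l hl => ?_⟩
    have h5 := chordForm_combo l.1 l.2 (show s + (1 - s) = 1 by ring) (pt x) 0
    rw [smul_zero, add_zero] at h5
    rw [h5]
    nlinarith [hcl l hl, chordForm_zero_neg (hΛ l hl), hs.1, hs.2]

theorem pt_mem_frontier_centralGap {Λ : Set (UnitAddCircle × UnitAddCircle)} {x : UnitAddCircle} :
    pt x ∈ frontier (centralGap Λ) ↔ x ∈ trace (centralGap Λ) := by
  have hcl : IsClosed (centralGap Λ) := isClosed_closure
  rw [hcl.frontier_eq]
  refine ⟨fun h => h.1, fun h => ⟨h, fun hi => ?_⟩⟩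
  have hsub : centralGap Λ ⊆ Metric.closedBall 0 1 :=
    closure_minimal ((connectedComponentIn_subset _ _).trans Set.sdiff_subset)
      Metric.isClosed_closedBall
  have := interior_mono hsub hi
  rw [interior_closedBall _ one_ne_zero, mem_ball_zero_iff, norm_pt] at this
  exact lt_irrefl _ this

theorem isClosed_trace_centralGap (Λ : Set (UnitAddCircle × UnitAddCircle)) :
    IsClosed (trace (centralGap Λ)) := isClosed_closure.preimage continuous_pt

/-! ### The orbit of a MAC leaf -/

/-- The chords `u v` and `p q` cross: seen counterclockwise from `u`, the points come in the order
`u`, `p`, `v`, `q`. -/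
def Crosses (u v p q : UnitAddCircle) : Prop :=
  0 < rep (p - u) ∧ rep (p - u) < rep (v - u) ∧ rep (v - u) < rep (q - u)

theorem crosses_iff_sbtw {u v p q : UnitAddCircle} :
    Crosses u v p q ↔ sbtw u p v ∧ sbtw v q u := by
  rw [sbtw_cyclic (a := v) (b := q) (c := u), sbtw_iff_rep, sbtw_iff_rep, Crosses]
  exact ⟨fun h => ⟨⟨h.1, h.2.1⟩, h.1.trans h.2.1, h.2.2⟩, fun h => ⟨h.1.1, h.1.2, h.2.2⟩⟩

/-- The leaves of the orbit of the leaf with endpoints `a`, `b`. -/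
def orbitLeaves (d : ℕ) (a b : UnitAddCircle) : Set (UnitAddCircle × UnitAddCircle) :=
  {l | ∃ j : ℕ, l = (leafMap d)^[j] (a, b) ∨ l = (leafMap d)^[j] (b, a)}

theorem leafMap_iterate (d j : ℕ) (p q : UnitAddCircle) :
    (leafMap d)^[j] (p, q) = ((sigma d)^[j] p, (sigma d)^[j] q) := by
  induction j with
  | zero => rfl
  | succ j ih => rw [Function.iterate_succ_apply', ih, Function.iterate_succ_apply',
      Function.iterate_succ_apply', leafMap]

theorem mem_orbitLeaves {d : ℕ} {a b p q : UnitAddCircle} : (p, q) ∈ orbitLeaves d a b ↔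
    ∃ j : ℕ, (p = (sigma d)^[j] a ∧ q = (sigma d)^[j] b) ∨
      (p = (sigma d)^[j] b ∧ q = (sigma d)^[j] a) := by
  simp [orbitLeaves, leafMap_iterate]

/-- The index of the sector `[a + i / d, a + (i + 1) / d)` that contains `y`. -/
noncomputable def sectorIndex (d : ℕ) (a y : UnitAddCircle) : ℕ := ⌊d * rep (y - a)⌋₊

theorem mul_rep_sub (d : ℕ) (a y : UnitAddCircle) :
    d * rep (y - a) = sectorIndex d a y + rep (sigma d y - sigma d a) := by
  have h : 0 ≤ d * rep (y - a) := mul_nonneg (Nat.cast_nonneg d) (rep_nonneg _)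
  rw [sectorIndex, ← sigma_sub, rep_sigma, natCast_floor_eq_intCast_floor h, Int.floor_add_fract]

/-- What the pullback construction uses of the orbit of a MAC leaf. -/
structure IsMajor (d : ℕ) (a b : UnitAddCircle) : Prop where
  two_le : 2 ≤ d
  lower : 1 - d * ccwLength a b ≤ ccwLength a b
  upper : d * ccwLength a b < 1
  not_crosses : ∀ {u v p q : UnitAddCircle}, (u, v) ∈ orbitLeaves d a b →
    (p, q) ∈ orbitLeaves d a b → ¬ Crosses u v p q
  periodic : ∃ N, 0 < N ∧ (sigma d)^[N] a = a ∧ (sigma d)^[N] b = b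
  right_fixed : ∀ k, (sigma d)^[k] a = a → (sigma d)^[k] b = b
  sectorIndex_eq : ∀ {p q : UnitAddCircle}, (p, q) ∈ orbitLeaves d a b →
    sectorIndex d a p = sectorIndex d a q
  rep_sigma_le : ∀ {p q : UnitAddCircle}, (p, q) ∈ orbitLeaves d a b →
    rep (sigma d p - sigma d a) ≤ d * ccwLength a b

/-! ### Periodic polygons and the compatible critical polygon -/

variable {d : ℕ} {V : Set UnitAddCircle} {a b x : UnitAddCircle}

theorem IsForwardInvariantPolygon.exists_period (hV : IsForwardInvariantPolygon d V) :
    ∃ N, 0 < N ∧ ∀ v ∈ V, (sigma d)^[N] v = v := by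
  obtain ⟨n, hn, hnV⟩ := hV.periodic
  have hmaps : Set.MapsTo (sigma d)^[n] V V := fun v hv => hnV ▸ Set.mem_image_of_mem _ hv
  have : Finite V := hV.finite
  let f : V → V := hmaps.restrict
  have hsurj : Function.Surjective f := by
    rintro ⟨v, hv⟩
    rw [← hnV] at hv
    obtain ⟨w, hw, rfl⟩ := hv
    exact ⟨⟨w, hw⟩, rfl⟩
  let e : Equiv.Perm V := Equiv.ofBijective f ⟨Finite.injective_iff_surjective.2 hsurj, hsurj⟩
  obtain ⟨m, hm, hme⟩ := (isOfFinOrder_of_finite e).exists_pow_eq_one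
  refine ⟨n * m, by positivity, fun v hv => ?_⟩
  have h1 : f^[m] ⟨v, hv⟩ = ⟨v, hv⟩ := by
    have : (e ^ m) ⟨v, hv⟩ = ⟨v, hv⟩ := by rw [hme]; rfl
    rwa [← Equiv.Perm.iterate_eq_pow] at this
  have h2 : ∀ k, ((f^[k] ⟨v, hv⟩ : V) : UnitAddCircle) = ((sigma d)^[n])^[k] v := fun k => by
    induction k with
    | zero => rfl
    | succ k ih => rw [Function.iterate_succ_apply', Function.iterate_succ_apply', ← ih]; rfl
  rw [Function.iterate_mul, ← h2, h1]

theorem eq_of_sigma_eq {N : ℕ} (hN : 0 < N) {p q : UnitAddCircle} (hp : (sigma d)^[N] p = p)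
    (hq : (sigma d)^[N] q = q) (h : sigma d p = sigma d q) : p = q := by
  obtain ⟨n, rfl⟩ := Nat.exists_eq_succ_of_ne_zero hN.ne'
  rw [← hp, ← hq, Function.iterate_succ_apply, Function.iterate_succ_apply, h]

theorem iterate_eq_of_mem_image {N k : ℕ} (hN : ∀ v ∈ V, (sigma d)^[N] v = v) {p : UnitAddCircle}
    (hp : p ∈ (sigma d)^[k] '' V) : (sigma d)^[N] p = p := by
  obtain ⟨v, hv, rfl⟩ := hp
  rw [← Function.iterate_add_apply, add_comm, Function.iterate_add_apply, hN v hv]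

theorem segment_subset_hull {W : Set UnitAddCircle} {p q : UnitAddCircle} (hp : p ∈ W)
    (hq : q ∈ W) : segment ℝ (pt p) (pt q) ⊆ hull W :=
  segment_subset_convexHull (Set.mem_image_of_mem _ hp) (Set.mem_image_of_mem _ hq)

theorem IsCompatible.not_crosses (hx : IsCompatible d V x) {k : ℕ} {u v p q : UnitAddCircle}
    (hp : p ∈ (sigma d)^[k] '' V) (hq : q ∈ (sigma d)^[k] '' V) (hu : sigma d u = sigma d x)
    (hv : sigma d v = sigma d x) : ¬ Crosses u v p q := by
  rintro ⟨h0, h1, h2⟩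
  obtain ⟨z, hz1, hz2, hz⟩ := exists_mem_segment_of_cross h0 h1 h2
  have := hx k ⟨segment_subset_hull hp hq hz2,
    segment_subset_hull (W := criticalPolygon d x) hu hv hz1⟩
  simp [circ] at this
  linarith

theorem sigma_add_coe_div (hd : 0 < d) (x : UnitAddCircle) (j : ℤ) (s : ℝ) :
    sigma d (x + (((j + s) / d : ℝ) : UnitAddCircle)) = sigma d x + (s : UnitAddCircle) := by
  have : (d : ℝ) ≠ 0 := by positivity
  rw [sigma_add, sigma_coe, mul_div_cancel₀ _ this, AddCircle.coe_add, coe_int_eq_zero, zero_add]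

/-- A chord from the interior of a sector to a point outside its closure crosses the side of the
critical polygon below that sector. Two distinct vertices of the critical polygon cannot both occur,
since periodic points with equal images coincide. Both `s` and `t` may be `0` or `1` because a
vertex of the critical polygon belongs to two sectors. -/
theorem IsCompatible.exists_sector (hd : 2 ≤ d) (hV : IsForwardInvariantPolygon d V)
    (hx : IsCompatible d V x) {k : ℕ} {p q : UnitAddCircle} (hp : p ∈ (sigma d)^[k] '' V)
    (hq : q ∈ (sigma d)^[k] '' V) : ∃ (j : ℤ) (s t : ℝ), 0 ≤ s ∧ s ≤ 1 ∧ 0 ≤ t ∧ t ≤ 1 ∧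
      p = x + (((j + s) / d : ℝ) : UnitAddCircle) ∧
      q = x + (((j + t) / d : ℝ) : UnitAddCircle) := by
  obtain ⟨N, hN, hNV⟩ := hV.exists_period
  have hd0 : (0 : ℝ) < d := by positivity
  have hd2 : (2 : ℝ) ≤ d := by exact_mod_cast hd
  wlog hle : d * rep (p - x) ≤ d * rep (q - x) generalizing p q
  · obtain ⟨j, s, t, h1, h2, h3, h4, h5, h6⟩ := this hq hp (le_of_not_ge hle)
    exact ⟨j, t, s, h3, h4, h1, h2, h6, h5⟩
  have hform : ∀ y : UnitAddCircle, ∃ (j : ℕ) (s : ℝ), 0 ≤ s ∧ s < 1 ∧ j + 1 ≤ d ∧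
      d * rep (y - x) = j + s ∧ y = x + (((j + s) / d : ℝ) : UnitAddCircle) := fun y => by
    have h1 := mul_rep_sub d x y
    refine ⟨sectorIndex d x y, rep (sigma d y - sigma d x), rep_nonneg _, rep_lt_one _, ?_, h1, ?_⟩
    · have h2 : (sectorIndex d x y : ℝ) < d := by
        have := rep_nonneg (sigma d y - sigma d x)
        have := rep_lt_one (y - x)
        nlinarith
      exact_mod_cast h2
    · rw [← h1, mul_div_cancel_left₀ _ hd0.ne', add_coe_rep_sub]
  obtain ⟨j, s, hs0, hs1, hjd, hj, hpx⟩ := hform p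
  obtain ⟨i, t, ht0, ht1, hid, hi, hqx⟩ := hform q
  rw [hj, hi] at hle
  have hjd' : (j : ℝ) + 1 ≤ d := by exact_mod_cast hjd
  have hid' : (i : ℝ) + 1 ≤ d := by exact_mod_cast hid
  have hvert : ∀ m : ℕ, sigma d (x + ((m / d : ℝ) : UnitAddCircle)) = sigma d x := fun m => by
    have := sigma_add_coe_div (d := d) (by omega) x (m : ℤ) 0
    simpa using this
  have hdiff : ∀ (m : ℕ) (r : ℝ), x + (((r / d : ℝ)) : UnitAddCircle) -
      (x + ((m / d : ℝ) : UnitAddCircle)) = (((r - m) / d : ℝ) : UnitAddCircle) := fun m r => by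
    rw [add_sub_add_left_eq_sub, ← AddCircle.coe_sub, sub_div]
  have hstep : ∀ m : ℕ, rep (x + ((((m + 1 : ℕ) : ℝ) / d : ℝ) : UnitAddCircle) -
      (x + ((m / d : ℝ) : UnitAddCircle))) = 1 / d := fun m => by
    rw [hdiff, show (((m + 1 : ℕ) : ℝ) - m) / d = 1 / d by push_cast; ring, rep_coe_eq
      (by positivity) (by rw [div_lt_one hd0]; linarith)]
  rcases lt_trichotomy i j with hij | hij | hij
  · have : (i : ℝ) + 1 ≤ j := by exact_mod_cast hij
    linarith
  · exact ⟨j, s, t, hs0, hs1.le, ht0, ht1.le, by simpa using hpx, by simpa [hij] using hqx⟩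
  have hij' : (j : ℝ) + 1 ≤ i := by exact_mod_cast hij
  rcases ht0.eq_or_lt with ht | ht
  · rcases hs0.eq_or_lt with hs | hs
    · have h1 : sigma d p = sigma d q := by
        rw [hpx, hqx, ← ht, ← hs, add_zero, add_zero, hvert, hvert]
      have h2 := eq_of_sigma_eq hN (iterate_eq_of_mem_image hNV hp)
        (iterate_eq_of_mem_image hNV hq) h1
      exact ⟨j, s, s, hs0, hs1.le, hs0, hs1.le, by simpa using hpx, by simpa [← h2] using hpx⟩
    · rcases Nat.lt_or_ge j i with h | h
      · rcases (Nat.succ_le_of_lt h).eq_or_lt with h | h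
        · exact ⟨j, s, 1, hs0, hs1.le, zero_le_one, le_rfl, by simpa using hpx, by
            rw [hqx, ← h, ← ht]; push_cast; simp⟩
        · exfalso
          have h' : (j : ℝ) + 1 < i := by exact_mod_cast h
          refine hx.not_crosses hp hq (hvert j) (hvert (j + 1)) ⟨?_, ?_, ?_⟩
          · rw [hpx, hdiff, rep_coe_eq] <;> rw [add_sub_cancel_left]
            · positivity
            · positivity
            · rw [div_lt_one hd0]; linarith
          · rw [hstep, hpx, hdiff, add_sub_cancel_left, rep_coe_eq (by positivity)
              (by rw [div_lt_one hd0]; linarith)]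
            gcongr
          · rw [hstep, hqx, hdiff, rep_coe_eq (div_nonneg (by linarith) hd0.le)
              (by rw [div_lt_one hd0]; linarith)]
            gcongr; linarith
      · omega
  -- The wrap-around case: `p = x` is also the far end of the last sector, so it is rewritten with
  -- offset `1` there.
  · by_cases hcorner : (j : ℝ) + s = 0 ∧ i + 1 = d
    · have hi1 : (i : ℝ) + 1 = d := by exact_mod_cast hcorner.2
      refine ⟨i, 1, t, zero_le_one, le_rfl, ht0, ht1.le, ?_, by simpa using hqx⟩
      rw [hpx, hcorner.1]
      push_cast
      rw [hi1, div_self hd0.ne', zero_div, AddCircle.coe_period]; simp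
    · exfalso
      have hpos : 0 < (j : ℝ) + s + (d - 1 - i) := by
        by_contra hc
        refine hcorner ⟨?_, ?_⟩
        · have : (0 : ℝ) ≤ j := Nat.cast_nonneg j
          linarith
        · have : (0 : ℝ) ≤ j := Nat.cast_nonneg j
          have : (i : ℝ) + 1 = d := by linarith
          exact_mod_cast this
      refine hx.not_crosses hq hp (hvert i) (hvert (i + 1)) ⟨?_, ?_, ?_⟩
      · rw [hqx, hdiff, add_sub_cancel_left, rep_coe_eq (by positivity)
          (by rw [div_lt_one hd0]; linarith)]
        positivity
      · rw [hstep, hqx, hdiff, add_sub_cancel_left, rep_coe_eq (by positivity)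
          (by rw [div_lt_one hd0]; linarith)]
        gcongr
      · have hj0 : (0 : ℝ) ≤ j := Nat.cast_nonneg j
        rw [hstep, hpx, hdiff, rep_coe_eq_add_one
          (by rw [le_div_iff₀ hd0]; linarith) (div_neg_of_neg_of_pos (by linarith) hd0)]
        rw [div_add_one hd0.ne']
        gcongr
        linarith

/-- A point inside a critical sector determines the sector. -/
theorem eq_of_add_coe_div_eq (hd : 0 < d) {x : UnitAddCircle} {j k : ℤ} {s w : ℝ} (hs0 : 0 ≤ s)
    (hs1 : s ≤ 1) (hw0 : 0 < w) (hw1 : w < 1)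
    (h : x + (((j + s) / d : ℝ) : UnitAddCircle) = x + (((k + w) / d : ℝ) : UnitAddCircle)) :
    s = w ∧ ∃ K : ℤ, j = k + K * d := by
  have hd0 : (0 : ℝ) < d := by positivity
  obtain ⟨K, hK⟩ := coe_eq_coe_iff.1 (add_left_cancel h)
  field_simp at hK
  have h1 : s - w = ((k + K * d - j : ℤ) : ℝ) := by push_cast; linarith
  have h2 : k + K * d - j = 0 := by
    have h3 : ((k + K * d - j : ℤ) : ℝ) < 1 := by rw [← h1]; linarith
    have h4 : (-1 : ℝ) < ((k + K * d - j : ℤ) : ℝ) := by rw [← h1]; linarith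
    have h3' : k + K * d - j < 1 := by exact_mod_cast h3
    have h4' : -1 < k + K * d - j := by exact_mod_cast h4
    omega
  rw [h2] at h1
  refine ⟨by push_cast at h1; linarith, K, by linarith⟩

theorem IsForwardInvariantPolygon.image_eq_of_mem (hV : IsForwardInvariantPolygon d V) {i j : ℕ}
    {y : UnitAddCircle} (hi : y ∈ (sigma d)^[i] '' V) (hj : y ∈ (sigma d)^[j] '' V) :
    (sigma d)^[i] '' V = (sigma d)^[j] '' V := by
  refine (hV.disjoint i j).resolve_right fun h => ?_
  exact Set.disjoint_left.1 h (subset_convexHull ℝ _ (Set.mem_image_of_mem _ hi))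
    (subset_convexHull ℝ _ (Set.mem_image_of_mem _ hj))

theorem sbtw_trichotomy {p q r : UnitAddCircle} (h1 : p ≠ q) (h2 : q ≠ r) (h3 : r ≠ p) :
    sbtw p q r ∨ sbtw r q p := by
  by_contra hc
  rw [not_or, ← btw_iff_not_sbtw, ← btw_iff_not_sbtw] at hc
  rcases hc.1.antisymm hc.2 with h | h | h
  · exact h2 h.symm
  · exact h1 h.symm
  · exact h3 h.symm

/-- If the polygon of `p`, `q` is the one that carries the leaf, order preservation pulls the
configuration back to `V`, where the leaf is a side and has all vertices on one side. Otherwise the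
two hulls are disjoint, but the chords would cross. -/
theorem IsForwardInvariantPolygon.not_sbtw_sbtw (hV : IsForwardInvariantPolygon d V)
    (hs : IsSide V a b) {k m : ℕ} {p q : UnitAddCircle} (hp : p ∈ (sigma d)^[k] '' V)
    (hq : q ∈ (sigma d)^[k] '' V) (h1 : sbtw ((sigma d)^[m] a) p ((sigma d)^[m] b))
    (h2 : sbtw ((sigma d)^[m] b) q ((sigma d)^[m] a)) : False := by
  rcases hV.disjoint k m with h | h
  · rw [h] at hp hq
    obtain ⟨p, hp, rfl⟩ := hp
    obtain ⟨q, hq, rfl⟩ := hq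
    obtain ⟨ha, hb, hab, hside⟩ := hs
    have key : ∀ {a b p : UnitAddCircle}, a ∈ V → b ∈ V → p ∈ V → a ≠ b →
        sbtw ((sigma d)^[m] a) ((sigma d)^[m] p) ((sigma d)^[m] b) → sbtw a p b := by
      intro a b p ha hb hp hab h
      refine (sbtw_trichotomy (p := a) (q := p) (r := b) ?_ ?_ hab.symm).resolve_right fun h' => ?_
      · rintro rfl; exact sbtw_irrefl_left h
      · rintro rfl; exact sbtw_irrefl_right h
      · exact sbtw_asymm h (hV.order m _ hb _ hp _ ha h')
    rcases hside with h | h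
    · exact h p hp (key ha hb hp hab h1)
    · exact h q hq (key hb ha hq hab.symm h2)
  · obtain ⟨h0, h1, h2⟩ := crosses_iff_sbtw.2 ⟨h1, h2⟩
    obtain ⟨z, hz1, hz2, -⟩ := exists_mem_segment_of_cross h0 h1 h2
    exact Set.disjoint_left.1 h (segment_subset_hull hp hq hz2)
      (segment_subset_hull (Set.mem_image_of_mem _ hs.1) (Set.mem_image_of_mem _ hs.2.1) hz1)

theorem exists_mem_image_of_mem_orbitLeaves (ha : a ∈ V) (hb : b ∈ V) {p q : UnitAddCircle}
    (h : (p, q) ∈ orbitLeaves d a b) : ∃ k, p ∈ (sigma d)^[k] '' V ∧ q ∈ (sigma d)^[k] '' V := by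
  obtain ⟨k, ⟨rfl, rfl⟩ | ⟨rfl, rfl⟩⟩ := mem_orbitLeaves.1 h
  · exact ⟨k, Set.mem_image_of_mem _ ha, Set.mem_image_of_mem _ hb⟩
  · exact ⟨k, Set.mem_image_of_mem _ hb, Set.mem_image_of_mem _ ha⟩

theorem IsForwardInvariantPolygon.not_crosses (hV : IsForwardInvariantPolygon d V)
    (hs : IsSide V a b) {u v p q : UnitAddCircle} (h : (u, v) ∈ orbitLeaves d a b)
    (h' : (p, q) ∈ orbitLeaves d a b) : ¬ Crosses u v p q := by
  rw [crosses_iff_sbtw]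
  rintro ⟨h1, h2⟩
  obtain ⟨k, hp, hq⟩ := exists_mem_image_of_mem_orbitLeaves hs.1 hs.2.1 h'
  obtain ⟨m, ⟨rfl, rfl⟩ | ⟨rfl, rfl⟩⟩ := mem_orbitLeaves.1 h
  · exact hV.not_sbtw_sbtw hs hp hq h1 h2
  · exact hV.not_sbtw_sbtw hs hq hp h2 h1

/-- The iterate permutes `V` and preserves the order seen from the fixed point `a`. If it moved `b`,
the further images of `b` would be strictly monotone in that order, against the periodicity of `b`.
-/
theorem IsForwardInvariantPolygon.right_fixed (hV : IsForwardInvariantPolygon d V) (ha : a ∈ V)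
    (hb : b ∈ V) (hab : a ≠ b) {k : ℕ} (hk : (sigma d)^[k] a = a) : (sigma d)^[k] b = b := by
  obtain ⟨N, hN, hNV⟩ := hV.exists_period
  have hVk : (sigma d)^[k] '' V = V := by
    have := hV.image_eq_of_mem (i := k) (j := 0) (y := a) ⟨a, ha, hk⟩ ⟨a, ha, rfl⟩
    simpa using this
  set f := (sigma d)^[k] with hf
  have hfV : ∀ v ∈ V, f v ∈ V := fun v hv => hVk ▸ Set.mem_image_of_mem _ hv
  have hfb : ∀ j, f^[j] b ∈ V := fun j => by
    induction j with
    | zero => exact hb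
    | succ j ih => rw [Function.iterate_succ_apply']; exact hfV _ ih
  have hfN : f^[N] b = b := by
    rw [hf, ← Function.iterate_mul, mul_comm, Function.iterate_mul]
    exact Function.iterate_fixed (hNV b hb) k
  by_contra hne
  have hfa : f b ≠ a := fun h => hab (by
    have h1 := iterate_eq_of_mem_image (k := 0) hNV (p := a) ⟨a, ha, rfl⟩
    have h2 : f^[N] b = f^[N] a := by
      obtain ⟨n, rfl⟩ := Nat.exists_eq_succ_of_ne_zero hN.ne'
      rw [Function.iterate_succ_apply, Function.iterate_succ_apply, h, hk]
    rw [hfN, Function.iterate_fixed hk] at h2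
    exact h2.symm)
  rcases sbtw_trichotomy (p := a) (q := f b) (r := b) hfa.symm hne hab.symm with h | h
  · have h1 : ∀ j, sbtw a (f^[j + 1] b) (f^[j] b) := fun j => by
      induction j with
      | zero => exact h
      | succ j ih =>
        have := hV.order k _ ha _ (hfb _) _ (hfb _) ih
        rwa [← hf, hk, ← Function.iterate_succ_apply' f, ← Function.iterate_succ_apply' f] at this
    have h2 : StrictAnti fun j => rep (f^[j] b - a) :=
      strictAnti_nat_of_succ_lt fun j => (sbtw_iff_rep.1 (h1 j)).2
    have h3 := h2 hN
    simp only [hfN, Function.iterate_zero, id] at h3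
    exact lt_irrefl _ h3
  · have h1 : ∀ j, sbtw a (f^[j] b) (f^[j + 1] b) := fun j => by
      induction j with
      | zero => exact sbtw_cyclic_right h
      | succ j ih =>
        have := hV.order k _ ha _ (hfb _) _ (hfb _) ih
        rwa [← hf, hk, ← Function.iterate_succ_apply' f, ← Function.iterate_succ_apply' f] at this
    have h2 : StrictMono fun j => rep (f^[j] b - a) :=
      strictMono_nat_of_lt_succ fun j => (sbtw_iff_rep.1 (h1 j)).2
    have h3 := h2 hN
    simp only [hfN, Function.iterate_zero, id] at h3
    exact lt_irrefl _ h3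

theorem swap_mem_orbitLeaves {p q : UnitAddCircle} (h : (p, q) ∈ orbitLeaves d a b) :
    (q, p) ∈ orbitLeaves d a b := by
  obtain ⟨j, h⟩ := mem_orbitLeaves.1 h
  exact mem_orbitLeaves.2 ⟨j, h.symm.imp And.symm And.symm⟩

theorem map_mem_orbitLeaves {p q : UnitAddCircle} (h : (p, q) ∈ orbitLeaves d a b) :
    (sigma d p, sigma d q) ∈ orbitLeaves d a b := by
  obtain ⟨j, h⟩ := mem_orbitLeaves.1 h
  refine mem_orbitLeaves.2 ⟨j + 1, ?_⟩
  rw [Function.iterate_succ_apply', Function.iterate_succ_apply']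
  rcases h with ⟨rfl, rfl⟩ | ⟨rfl, rfl⟩
  · exact Or.inl ⟨rfl, rfl⟩
  · exact Or.inr ⟨rfl, rfl⟩

theorem iterate_mem_orbitLeaves (d : ℕ) (a b : UnitAddCircle) (k : ℕ) :
    ((sigma d)^[k] a, (sigma d)^[k] b) ∈ orbitLeaves d a b :=
  mem_orbitLeaves.2 ⟨k, Or.inl ⟨rfl, rfl⟩⟩

/-- A closed sector has length `1/d`, and its two ends have the same image, so distinct periodic
points cannot occupy both. -/
theorem IsCompatible.dist_lt (hd : 2 ≤ d) (hV : IsForwardInvariantPolygon d V)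
    (hx : IsCompatible d V x) {k : ℕ} {p q : UnitAddCircle} (hp : p ∈ (sigma d)^[k] '' V)
    (hq : q ∈ (sigma d)^[k] '' V) : dist p q < 1 / d := by
  obtain ⟨N, hN, hNV⟩ := hV.exists_period
  have hd0 : (0 : ℝ) < d := by positivity
  have hd2 : (2 : ℝ) ≤ d := by exact_mod_cast hd
  by_cases hpq : p = q
  · rw [hpq, dist_self]; positivity
  obtain ⟨j, s, t, hs0, hs1, ht0, ht1, hps, hqt⟩ := hx.exists_sector hd hV hp hq
  have hst : |t - s| < 1 := by
    rw [abs_lt]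
    by_contra hc
    have hσ : sigma d p = sigma d q := by
      rw [hps, hqt, sigma_add_coe_div (by omega), sigma_add_coe_div (by omega)]
      congr 1
      rw [coe_eq_coe_iff]
      by_cases h : s < t
      · exact ⟨-1, by push_cast; by_contra h'; exact hc ⟨by linarith, lt_of_le_of_ne (by linarith)
          fun h'' => h' (by linarith)⟩⟩
      · exact ⟨1, by push_cast; by_contra h'; exact hc ⟨lt_of_le_of_ne (by linarith)
          fun h'' => h' (by linarith), by linarith⟩⟩
    exact hpq (eq_of_sigma_eq hN (iterate_eq_of_mem_image hNV hp)
      (iterate_eq_of_mem_image hNV hq) hσ)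
  have h1 : q - p = (((t - s) / d : ℝ) : UnitAddCircle) := by
    rw [hps, hqt, add_sub_add_left_eq_sub, ← AddCircle.coe_sub]
    congr 1; ring
  have h2 : |(t - s) / d| < 1 / d := by
    rw [abs_div, abs_of_pos hd0]; gcongr
  have h3 : (1 : ℝ) / d ≤ 1 / 2 := by gcongr
  rw [dist_comm, dist_eq_norm, h1, norm_coe_of_abs_le (by linarith)]
  exact h2

/-- A sibling lies in one sector of the critical polygon at `x`, and a leaf with an end strictly
under it lies in the same sector. There `sigma d` is affine, so a crossing would persist for the
images, which are orbit leaves. The only escape is that the two ends of the sector, which have the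
same image, are both endpoints; this makes `q` equal to `a` or `b`. -/
theorem IsCompatible.not_crosses_sibling (hd : 2 ≤ d) (hV : IsForwardInvariantPolygon d V)
    (hx : IsCompatible d V x) (hs : IsSide V a b) (hl : ccwLength a b < 1 / d) (i : ℤ)
    {p q : UnitAddCircle} (hpq : (p, q) ∈ orbitLeaves d a b) :
    ¬ Crosses (a + ((i / d : ℝ) : UnitAddCircle)) (b + ((i / d : ℝ) : UnitAddCircle)) p q := by
  obtain ⟨N, hN, hNV⟩ := hV.exists_period
  have hd0 : (0 : ℝ) < d := by positivity
  have hd2 : (2 : ℝ) ≤ d := by exact_mod_cast hd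
  have hdpos : 0 < d := by omega
  obtain ⟨k, hp, hq⟩ := exists_mem_image_of_mem_orbitLeaves hs.1 hs.2.1 hpq
  have haV : a ∈ (sigma d)^[0] '' V := ⟨a, hs.1, rfl⟩
  have hbV : b ∈ (sigma d)^[0] '' V := ⟨b, hs.2.1, rfl⟩
  obtain ⟨j, s, t, hs0, hs1, ht0, ht1, has, hbt⟩ := hx.exists_sector hd hV haV hbV
  obtain ⟨j', s', t', hs0', hs1', ht0', ht1', hps, hqt⟩ := hx.exists_sector hd hV hp hq
  have hba : b - a = (((t - s) / d : ℝ) : UnitAddCircle) := by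
    rw [has, hbt, add_sub_add_left_eq_sub, ← AddCircle.coe_sub]
    congr 1; ring
  have hst : s ≤ t := by
    by_contra hc
    have h1 : rep (b - a) = (t - s) / d + 1 := by
      rw [hba, rep_coe_eq_add_one]
      · rw [le_div_iff₀ hd0]; nlinarith
      · exact div_neg_of_neg_of_pos (by linarith) hd0
    have h2 : (t - s) / d ≥ -(1 / d) := by rw [ge_iff_le, ← neg_div]; gcongr; linarith
    have h3 : (1 : ℝ) / d ≤ 1 / 2 := by gcongr
    unfold ccwLength at hl
    linarith
  have hlst : rep (b - a) = (t - s) / d := by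
    rw [hba, rep_coe_eq (div_nonneg (by linarith) hd0.le)]
    rw [div_lt_one hd0]; linarith
  have hst1 : t - s < 1 := by
    rw [ccwLength, hlst] at hl
    rwa [div_lt_div_iff_of_pos_right hd0] at hl
  rintro ⟨h0, h1, h2⟩
  set a' := a + ((i / d : ℝ) : UnitAddCircle) with ha'
  rw [show b + ((i / d : ℝ) : UnitAddCircle) - a' = b - a by rw [ha']; abel, hlst] at h1 h2
  set e := rep (p - a') with he
  have hde : d * e < t - s := by rw [lt_div_iff₀ hd0] at h1; linarith
  have hde0 : 0 < d * e := by positivity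
  obtain ⟨w, hw⟩ : ∃ w, w = s + d * e := ⟨_, rfl⟩
  have hpw : p = x + ((((j + i : ℤ) + w) / d : ℝ) : UnitAddCircle) := by
    rw [← add_coe_rep_sub a' p, ← he, ha', has, add_assoc, add_assoc, ← AddCircle.coe_add,
      ← AddCircle.coe_add]
    congr 2
    rw [hw]; push_cast; field_simp; ring
  have hw0 : 0 < w := by linarith
  have hw1 : w < 1 := by linarith
  obtain ⟨hsw, K, hK⟩ := eq_of_add_coe_div_eq hdpos hs0' hs1' hw0 hw1 (hps.symm.trans hpw)
  have hqt' : q = x + ((((j + i : ℤ) + t') / d : ℝ) : UnitAddCircle) := by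
    rw [hqt, hK]
    congr 1
    rw [coe_eq_coe_iff]
    exact ⟨K, by push_cast; field_simp; ring⟩
  have hqa' : q - a' = (((t' - s) / d : ℝ) : UnitAddCircle) := by
    rw [hqt', ha', has, add_assoc, add_sub_add_left_eq_sub, ← AddCircle.coe_add,
      ← AddCircle.coe_sub]
    congr 1; push_cast; ring
  have hσa : sigma d a = sigma d x + (s : UnitAddCircle) := by rw [has, sigma_add_coe_div hdpos]
  have hσb : sigma d b = sigma d x + (t : UnitAddCircle) := by rw [hbt, sigma_add_coe_div hdpos]
  have hσp : sigma d p = sigma d x + (w : UnitAddCircle) := by rw [hpw, sigma_add_coe_div hdpos]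
  have hσq : sigma d q = sigma d x + (t' : UnitAddCircle) := by rw [hqt', sigma_add_coe_div hdpos]
  have hdiff : ∀ y z : ℝ, sigma d x + (y : UnitAddCircle) - (sigma d x + (z : UnitAddCircle)) =
      ((y - z : ℝ) : UnitAddCircle) := fun y z => by
    rw [add_sub_add_left_eq_sub, AddCircle.coe_sub]
  have hO : (a, b) ∈ orbitLeaves d a b := iterate_mem_orbitLeaves d a b 0
  have hnc : ¬ Crosses (sigma d a) (sigma d b) (sigma d p) (sigma d q) :=
    hV.not_crosses hs (map_mem_orbitLeaves hO) (map_mem_orbitLeaves hpq)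
  have hnc' : ¬ t - s < rep (sigma d q - sigma d a) := fun h => by
    refine hnc ⟨?_, ?_, ?_⟩
    · rw [hσp, hσa, hdiff, rep_coe_eq] <;> linarith
    · rw [hσp, hσa, hσb, hdiff, hdiff, rep_coe_eq, rep_coe_eq] <;> linarith
    · rwa [hσb, hσa, hdiff, rep_coe_eq (by linarith) (by linarith), ← hσa]
  rw [hσq, hσa, hdiff] at hnc'
  have hdvd : ∀ {K : ℤ}, (1 : ℤ) = K * d → False := fun {K} h => by
    have h1 : (d : ℤ) ∣ 1 := ⟨K, by linarith⟩
    have h2 := Int.le_of_dvd one_pos h1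
    omega
  -- Orbit polygons that share a vertex are equal, so if `q` is `a` or `b` then `p` is a vertex of
  -- `V`.
  have hper : ∀ y, y ∈ V → q = y → p ∈ (sigma d)^[0] '' V :=
    fun y hy hqy => (hV.image_eq_of_mem (i := k) (j := 0) hq ⟨y, hy, hqy.symm⟩) ▸ hp
  rcases lt_or_ge t' s with hts | hts
  · have hle : ¬ t - t' < 1 := fun h => hnc' (by
      rw [rep_coe_eq_add_one] <;> linarith)
    have ht1 : t = 1 := by linarith
    have ht0' : t' = 0 := by linarith
    have hqb : q = b := by
      refine eq_of_sigma_eq hN (iterate_eq_of_mem_image hNV hq) (iterate_eq_of_mem_image hNV hbV) ?_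
      rw [hσq, hσb, ht1, ht0']
      congr 1
      exact coe_eq_coe_iff.2 ⟨-1, by norm_num⟩
    have hpV := hper b hs.2.1 hqb
    -- Now `p` and `a`, both interior to sectors, must share one modulo `d`, whereas `q = b` places
    -- these sectors side by side.
    obtain ⟨j₂, α, β, hα0, hα1, hβ0, hβ1, hpα, haβ⟩ := hx.exists_sector hd hV hpV haV
    obtain ⟨-, K₁, hK₁⟩ := eq_of_add_coe_div_eq hdpos hα0 hα1 hw0 hw1 (hpα.symm.trans hpw)
    obtain ⟨-, K₂, hK₂⟩ := eq_of_add_coe_div_eq hdpos hβ0 hβ1 (by linarith) (by linarith)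
      (haβ.symm.trans has)
    rw [hqt', hbt, ht1, ht0'] at hqb
    obtain ⟨K₃, hK₃⟩ := coe_eq_coe_iff.1 (add_left_cancel hqb)
    have hK₃' : (j + i : ℤ) = j + 1 + K₃ * d := by
      have : ((j + i : ℤ) : ℝ) = ((j + 1 + K₃ * d : ℤ) : ℝ) := by
        push_cast at hK₃ ⊢; field_simp at hK₃; linarith
      exact_mod_cast this
    exact hdvd (K := K₂ - K₁ - K₃) (by linarith)
  · have htt : t < t' := by
      rw [hqa', rep_coe_eq (div_nonneg (by linarith) hd0.le)] at h2
      · rw [div_lt_div_iff_of_pos_right hd0] at h2; linarith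
      · rw [div_lt_one hd0]; linarith
    have hle : ¬ t' - s < 1 := fun h => hnc' (by
      rw [rep_coe_eq] <;> linarith)
    have ht1 : t' = 1 := by linarith
    have hs0 : s = 0 := by linarith
    have hqa : q = a := by
      refine eq_of_sigma_eq hN (iterate_eq_of_mem_image hNV hq) (iterate_eq_of_mem_image hNV haV) ?_
      rw [hσq, hσa, ht1, hs0]
      congr 1
      exact coe_eq_coe_iff.2 ⟨1, by norm_num⟩
    have hpV := hper a hs.1 hqa
    -- The mirror image of the previous case, with `b` in place of `a`.
    obtain ⟨j₂, α, β, hα0, hα1, hβ0, hβ1, hpα, hbβ⟩ := hx.exists_sector hd hV hpV hbV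
    obtain ⟨-, K₁, hK₁⟩ := eq_of_add_coe_div_eq hdpos hα0 hα1 hw0 hw1 (hpα.symm.trans hpw)
    obtain ⟨-, K₂, hK₂⟩ := eq_of_add_coe_div_eq hdpos hβ0 hβ1 (by linarith) (by linarith)
      (hbβ.symm.trans hbt)
    rw [hqt', has, ht1, hs0] at hqa
    obtain ⟨K₃, hK₃⟩ := coe_eq_coe_iff.1 (add_left_cancel hqa)
    have hK₃' : (j + i : ℤ) + 1 = j + K₃ * d := by
      have : ((j + i : ℤ) : ℝ) + 1 = ((j + K₃ * d : ℤ) : ℝ) := by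
        push_cast at hK₃ ⊢; field_simp at hK₃; linarith
      exact_mod_cast this
    exact hdvd (K := K₃ + K₁ - K₂) (by linarith)

/-! ### The orbit leaves lie under siblings of the major -/

theorem sectorIndex_eq_of {d : ℕ} {c y : UnitAddCircle} {n : ℕ} {s : ℝ} (hs0 : 0 ≤ s) (hs1 : s < 1)
    (h : d * rep (y - c) = n + s) :
    sectorIndex d c y = n ∧ rep (sigma d y - sigma d c) = s := by
  have h1 : sectorIndex d c y = n := by
    rw [sectorIndex, h, Nat.floor_eq_iff (by positivity)]; constructor <;> linarith
  refine ⟨h1, ?_⟩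
  have := mul_rep_sub d c y
  rw [h, h1] at this
  linarith

/-- In units of `1/d`, a leaf that starts under a sibling must end under it, or it would cross it. A
leaf that starts in an endcap is longer than the endcap and, having length at most `l`, ends
strictly under the next sibling, which it crosses. -/
theorem sector_of_not_crosses (hd : 2 ≤ d) (hupper : d * ccwLength a b < 1)
    {p q : UnitAddCircle} {u : ℝ} (hu : q = p + (u : UnitAddCircle))
    (hu0 : 1 - d * ccwLength a b ≤ u) (hul : u ≤ ccwLength a b)
    (h1 : ∀ i : ℤ,
      ¬ Crosses (a + ((i / d : ℝ) : UnitAddCircle)) (b + ((i / d : ℝ) : UnitAddCircle)) p q)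
    (h2 : ∀ i : ℤ,
      ¬ Crosses (a + ((i / d : ℝ) : UnitAddCircle)) (b + ((i / d : ℝ) : UnitAddCircle)) q p) :
    sectorIndex d a p = sectorIndex d a q ∧
      rep (sigma d p - sigma d a) ≤ d * ccwLength a b ∧
      rep (sigma d q - sigma d a) ≤ d * ccwLength a b := by
  have hd0 : (0 : ℝ) < d := by positivity
  have hd2 : (2 : ℝ) ≤ d := by exact_mod_cast hd
  set l := ccwLength a b with hl
  have hl' : rep (b - a) = l := rfl
  have hmul := mul_rep_sub d a p
  have hs0 := rep_nonneg (sigma d p - sigma d a)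
  have hs1 := rep_lt_one (sigma d p - sigma d a)
  set n := sectorIndex d a p with hn
  set s := rep (sigma d p - sigma d a) with hs
  have hpr : rep (p - a) = (n + s) / d := by rw [← hmul]; field_simp
  have hp : p = a + (((n + s) / d : ℝ) : UnitAddCircle) := by rw [← hpr, add_coe_rep_sub]
  have hq : q = a + (((n + (s + d * u)) / d : ℝ) : UnitAddCircle) := by
    rw [hu, hp, add_assoc, ← AddCircle.coe_add]; congr 2; field_simp; ring
  have hnd : (n : ℝ) + 1 ≤ d := by
    have h3 : (n : ℝ) < d := by
      have := rep_lt_one (p - a)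
      rw [hpr, div_lt_one hd0] at this
      linarith
    have h4 : n < d := by exact_mod_cast h3
    exact_mod_cast h4
  have hbb : ∀ r : UnitAddCircle, rep (b + r - (a + r)) = l := fun r => by
    rw [add_sub_add_right_eq_sub, hl']
  have hdiff : ∀ r r' : ℝ, a + (r : UnitAddCircle) - (a + (r' : UnitAddCircle)) =
      ((r - r' : ℝ) : UnitAddCircle) := fun r r' => by
    rw [add_sub_add_left_eq_sub, AddCircle.coe_sub]
  have hl2 : l < 1 / 2 := by nlinarith
  rcases le_or_gt (s + d * u) (d * l) with hcase | hcase
  · have h3 : d * rep (q - a) = n + (s + d * u) := by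
      rw [hq, add_sub_cancel_left, rep_coe_eq]
      · field_simp
      · have : 0 ≤ d * u := by nlinarith
        positivity
      · rw [div_lt_one hd0]; linarith
    obtain ⟨h4, h5⟩ := sectorIndex_eq_of (by nlinarith) (by linarith) h3
    exact ⟨h4.symm, by nlinarith, by rw [h5]; exact hcase⟩
  · exfalso
    rcases lt_or_ge s (d * l) with hsl | hsl
    · have hspos : 0 < s := by nlinarith
      refine h1 n ⟨?_, ?_, ?_⟩
      · rw [hp, hdiff, show ((n + s) / d - ((n : ℤ) : ℝ) / d : ℝ) = s / d by push_cast; ring,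
          rep_coe_eq (by positivity) (by rw [div_lt_one hd0]; linarith)]
        positivity
      · rw [hbb, hp, hdiff, show ((n + s) / d - ((n : ℤ) : ℝ) / d : ℝ) = s / d by push_cast; ring,
          rep_coe_eq (by positivity) (by rw [div_lt_one hd0]; linarith), div_lt_iff₀ hd0]
        linarith
      · rw [hbb, hq, hdiff, show ((n + (s + d * u)) / d - ((n : ℤ) : ℝ) / d : ℝ) = (s + d * u) / d by
          push_cast; ring, rep_coe_eq (div_nonneg (by nlinarith) hd0.le)
          (by rw [div_lt_one hd0]; nlinarith), lt_div_iff₀ hd0]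
        linarith
    · have e1 : ((n + (s + d * u)) / d - (((n + 1 : ℤ)) : ℝ) / d : ℝ) = (s + d * u - 1) / d := by
        push_cast; ring
      have e2 : ((n + s) / d - (((n + 1 : ℤ)) : ℝ) / d : ℝ) = (s - 1) / d := by push_cast; ring
      -- From `s ≥ d l` and `u ≥ 1 - d l`, the left side exceeds or equals `(d - 1)(1 - d l)`.
      have hpos : 0 < s + d * u - 1 := by nlinarith
      have hlt : (s + d * u - 1) / d < l := by rw [div_lt_iff₀ hd0]; nlinarith
      refine h2 (n + 1) ⟨?_, ?_, ?_⟩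
      · rw [hq, hdiff, e1, rep_coe_eq (by positivity) (by linarith)]
        positivity
      · rw [hbb, hq, hdiff, e1, rep_coe_eq (by positivity) (by linarith)]
        exact hlt
      · rw [hbb, hp, hdiff, e2, rep_coe_eq_add_one (by rw [le_div_iff₀ hd0]; linarith)
          (div_neg_of_neg_of_pos (by linarith) hd0), div_add_one hd0.ne', lt_div_iff₀ hd0]
        nlinarith

/-- All orbit leaves are shorter than `1/d`, so the extremal property says that the major is the
longest. This bounds the lengths from both sides and puts each leaf under a sibling by
`sector_of_not_crosses`. -/
theorem IsMACLeaf.isMajor (hd : 2 ≤ d) (hM : IsMACLeaf d a b) (hab : ccwLength a b < 1 / 2) :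
    IsMajor d a b := by
  obtain ⟨⟨V, hV, hs, x, hx⟩, hmax⟩ := hM
  have hd0 : (0 : ℝ) < d := by positivity
  have hd2 : (2 : ℝ) ≤ d := by exact_mod_cast hd
  obtain ⟨N, hN, hNV⟩ := hV.exists_period
  have haV : a ∈ (sigma d)^[0] '' V := ⟨a, hs.1, rfl⟩
  have hbV : b ∈ (sigma d)^[0] '' V := ⟨b, hs.2.1, rfl⟩
  have hne : a ≠ b := hs.2.2.1
  have hlen : dist a b = ccwLength a b := dist_eq_ccwLength hab.le
  have hlt : ∀ k, dist ((sigma d)^[k] a) ((sigma d)^[k] b) < 1 / d := fun k =>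
    hx.dist_lt hd hV (k := k) ⟨a, hs.1, rfl⟩ ⟨b, hs.2.1, rfl⟩
  have hl : ccwLength a b < 1 / d := by rw [← hlen]; exact hlt 0
  have hle : ∀ k, dist ((sigma d)^[k] a) ((sigma d)^[k] b) ≤ ccwLength a b := fun k => by
    have h1 := hmax k
    rw [leafMap_iterate] at h1
    simp only [leafLength] at h1
    rw [hlen, abs_of_neg (by linarith), abs_of_neg (by linarith [hlt k])] at h1
    linarith
  have hupper : d * ccwLength a b < 1 := by rw [lt_div_iff₀ hd0] at hl; linarith
  have hpos : 0 < ccwLength a b := rep_sub_pos.2 hne.symm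
  -- The image of the major has length `d l` or `1 - d l`; the first would exceed `l`.
  have hlower : 1 - d * ccwLength a b ≤ ccwLength a b := by
    have h1 : dist (sigma d a) (sigma d b) = ‖((d * ccwLength a b : ℝ) : UnitAddCircle)‖ := by
      rw [dist_comm, dist_eq_norm, ← sigma_sub, ← sigma_coe, ccwLength, coe_rep]
    have h2 := hle 1
    simp only [Function.iterate_one] at h2
    have h3 : |d * ccwLength a b| = d * ccwLength a b := abs_of_pos (by positivity)
    rcases le_total |d * ccwLength a b| (1 / 2) with h | h
    · rw [h1, norm_coe_of_abs_le h, h3] at h2; nlinarith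
    · rw [h1, norm_coe_of_half_le h (by linarith), h3] at h2; exact h2
  have hmin : ∀ k, 1 - d * ccwLength a b ≤ dist ((sigma d)^[k] a) ((sigma d)^[k] b) := by
    intro k
    by_contra hc
    rw [not_le] at hc
    obtain ⟨m, -, hm⟩ := Finset.exists_min_image (Finset.range N)
      (fun m => dist ((sigma d)^[m] a) ((sigma d)^[m] b)) ⟨0, Finset.mem_range.2 hN⟩
    have hmod : ∀ j, dist ((sigma d)^[m] a) ((sigma d)^[m] b) ≤
        dist ((sigma d)^[j] a) ((sigma d)^[j] b) := fun j => by
      have := hm (j % N) (Finset.mem_range.2 (Nat.mod_lt _ hN))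
      rwa [Function.IsPeriodicPt.iterate_mod_apply (hNV a hs.1),
        Function.IsPeriodicPt.iterate_mod_apply (hNV b hs.2.1)] at this
    -- The index `m + N - 1` is a predecessor of `m` in the periodic orbit, valid also for `m = 0`.
    -- Its leaf would be shorter than the shortest one.
    have hstep := dist_sigma_eq hupper.le (hle (m + N - 1))
    rw [← Function.iterate_succ_apply' (sigma d), ← Function.iterate_succ_apply' (sigma d),
      show (m + N - 1).succ = m + N by omega, Function.iterate_add_apply,
      Function.iterate_add_apply, hNV a hs.1, hNV b hs.2.1] at hstep
    have h1 := hstep ((hmod k).trans_lt hc)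
    have h2 := hmod (m + N - 1)
    have h3 : 0 < dist ((sigma d)^[m] a) ((sigma d)^[m] b) := by
      rw [dist_pos]
      intro h
      have h4 : ∀ i, (sigma d)^[m + i] a = (sigma d)^[m + i] b := fun i => by
        rw [add_comm, Function.iterate_add_apply, h, ← Function.iterate_add_apply]
      have h5 : (sigma d)^[N * m] a = (sigma d)^[N * m] b := by
        have h6 : m ≤ N * m := Nat.le_mul_of_pos_left _ hN
        have := h4 (N * m - m)
        rwa [Nat.add_sub_cancel' h6] at this
      rw [Function.iterate_mul, Function.iterate_fixed (hNV a hs.1),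
        Function.iterate_fixed (hNV b hs.2.1)] at h5
      exact hne h5
    nlinarith
  have hsector : ∀ {p q : UnitAddCircle}, (p, q) ∈ orbitLeaves d a b →
      sectorIndex d a p = sectorIndex d a q ∧
      rep (sigma d p - sigma d a) ≤ d * ccwLength a b := by
    intro p q hpq
    have hpq' := swap_mem_orbitLeaves hpq
    obtain ⟨u, hu, hud, -⟩ := exists_coe_eq_sub p q
    have hdl : 1 - d * ccwLength a b ≤ dist p q ∧ dist p q ≤ ccwLength a b := by
      obtain ⟨k, ⟨rfl, rfl⟩ | ⟨rfl, rfl⟩⟩ := mem_orbitLeaves.1 hpq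
      · exact ⟨hmin k, hle k⟩
      · rw [dist_comm]; exact ⟨hmin k, hle k⟩
    rw [← hud] at hdl
    have hc := fun i => hx.not_crosses_sibling hd hV hs hl i hpq
    have hc' := fun i => hx.not_crosses_sibling hd hV hs hl i hpq'
    rcases le_total 0 u with h | h
    · rw [abs_of_nonneg h] at hdl
      obtain ⟨h1, h2, -⟩ := sector_of_not_crosses hd hupper hu hdl.1 hdl.2 hc hc'
      exact ⟨h1, h2⟩
    · rw [abs_of_nonpos h] at hdl
      obtain ⟨h1, -, h2⟩ := sector_of_not_crosses hd hupper (u := -u)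
        (by rw [hu, AddCircle.coe_neg]; abel) hdl.1 hdl.2 hc' hc
      exact ⟨h1.symm, h2⟩
  exact
    { two_le := hd
      lower := hlower
      upper := hupper
      not_crosses := hV.not_crosses hs
      periodic := ⟨N, hN, hNV a hs.1, hNV b hs.2.1⟩
      right_fixed := fun k => hV.right_fixed hs.1 hs.2.1 hne
      sectorIndex_eq := fun h => (hsector h).1
      rep_sigma_le := fun h => (hsector h).2 }

/-! ### The pullback of the orbit -/

/-- The union of all stages of the pullback. -/
def pullback (d : ℕ) (a b : UnitAddCircle) (τ : Fin d → UnitAddCircle → UnitAddCircle) :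
    Set (UnitAddCircle × UnitAddCircle) :=
  ⋃ n : ℕ, pullbackStage d a b τ n

section pullback

variable {τ : Fin d → UnitAddCircle → UnitAddCircle}

theorem orbitLeaves_subset_pullback : orbitLeaves d a b ⊆ pullback d a b τ :=
  Set.subset_iUnion (pullbackStage d a b τ) 0

theorem branch_mem_pullback (i : Fin d) {p q : UnitAddCircle} (h : (p, q) ∈ pullback d a b τ) :
    (τ i p, τ i q) ∈ pullback d a b τ := by
  obtain ⟨n, hn⟩ := Set.mem_iUnion.1 h
  exact Set.mem_iUnion.2 ⟨n + 1, Or.inr (Set.mem_iUnion.2 ⟨i, _, hn, rfl⟩)⟩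

theorem pullback_induction {P : UnitAddCircle → UnitAddCircle → Prop}
    (h0 : ∀ p q, (p, q) ∈ orbitLeaves d a b → P p q)
    (h1 : ∀ i p q, (p, q) ∈ pullback d a b τ → P p q → P (τ i p) (τ i q))
    {p q : UnitAddCircle} (h : (p, q) ∈ pullback d a b τ) : P p q := by
  obtain ⟨n, hn⟩ := Set.mem_iUnion.1 h
  clear h
  induction n generalizing p q with
  | zero => exact h0 p q hn
  | succ n ih =>
    rcases hn with hn | hn
    · exact ih hn
    · obtain ⟨i, ⟨p', q'⟩, hn', he⟩ := Set.mem_iUnion.1 hn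
      obtain ⟨rfl, rfl⟩ := Prod.mk.inj he
      exact h1 i p' q' (Set.mem_iUnion.2 ⟨n, hn'⟩) (ih hn')

theorem swap_mem_pullback {p q : UnitAddCircle} (h : (p, q) ∈ pullback d a b τ) :
    (q, p) ∈ pullback d a b τ :=
  pullback_induction (P := fun p q => (q, p) ∈ pullback d a b τ)
    (fun _ _ h => orbitLeaves_subset_pullback (swap_mem_orbitLeaves h))
    (fun i _ _ _ h => branch_mem_pullback i h) h

end pullback

/-! ### Branches and the circular order -/

theorem rep_ccwBranch_sub (i : Fin d) (t : UnitAddCircle) :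
    rep (ccwBranch d a i t - a) = ((i : ℕ) + rep (t - sigma d a)) / d := by
  have hd : (0 : ℝ) < d := by have := i.pos; positivity
  have h0 := rep_nonneg (t - sigma d a)
  have h1 := rep_lt_one (t - sigma d a)
  have h2 : ((i : ℕ) : ℝ) + 1 ≤ d := by exact_mod_cast i.2
  rw [ccwBranch, add_sub_cancel_left, rep_coe_eq (by positivity)]
  rw [div_lt_one hd]; linarith

theorem sectorIndex_ccwBranch (i : Fin d) (t : UnitAddCircle) :
    sectorIndex d a (ccwBranch d a i t) = i := by
  have hd : (0 : ℝ) < d := by have := i.pos; positivity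
  refine (sectorIndex_eq_of (rep_nonneg (t - sigma d a)) (rep_lt_one _) ?_).1
  rw [rep_ccwBranch_sub]; field_simp

theorem sectorIndex_lt (hd : 0 < d) (a y : UnitAddCircle) : sectorIndex d a y < d := by
  have hd0 : (0 : ℝ) < d := by positivity
  have h1 := mul_rep_sub d a y
  have h2 := rep_lt_one (y - a)
  have h3 := rep_nonneg (sigma d y - sigma d a)
  have : (sectorIndex d a y : ℝ) < d := by nlinarith
  exact_mod_cast this

theorem ccwBranch_sigma {i : Fin d} {y : UnitAddCircle} (h : sectorIndex d a y = i) :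
    ccwBranch d a i (sigma d y) = y := by
  have hd : (0 : ℝ) < d := by have := i.pos; positivity
  have h1 := mul_rep_sub d a y
  rw [ccwBranch, ← h, ← h1, mul_div_cancel_left₀ _ hd.ne', add_coe_rep_sub]

theorem sectorIndex_mono {x y : UnitAddCircle} (h : rep (x - a) ≤ rep (y - a)) :
    sectorIndex d a x ≤ sectorIndex d a y :=
  Nat.floor_le_floor (by gcongr)

/-- A branch scales offsets from `sigma d a` by `1/d`. Measured from `c`, a point passes the cut at
`sigma d a` exactly when its branch value passes the cut at `a`, so comparisons agree. -/
theorem rep_sub_lt_iff_of_sector {i : Fin d} {c p y : UnitAddCircle} :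
    rep (ccwBranch d a i p - ccwBranch d a i c) < rep (ccwBranch d a i y - ccwBranch d a i c) ↔
      rep (p - c) < rep (y - c) := by
  have hd : (0 : ℝ) < d := by have := i.pos; positivity
  have key : ∀ y, (rep (c - sigma d a) ≤ rep (y - sigma d a) ∧
        rep (y - c) = rep (y - sigma d a) - rep (c - sigma d a) ∧
        rep (ccwBranch d a i y - ccwBranch d a i c) =
          (rep (y - sigma d a) - rep (c - sigma d a)) / d) ∨
      (rep (y - sigma d a) < rep (c - sigma d a) ∧
        rep (y - c) = rep (y - sigma d a) - rep (c - sigma d a) + 1 ∧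
        rep (ccwBranch d a i y - ccwBranch d a i c) =
          (rep (y - sigma d a) - rep (c - sigma d a)) / d + 1) := fun y => by
    rcases le_or_gt (rep (c - sigma d a)) (rep (y - sigma d a)) with h | h
    · refine Or.inl ⟨h, rep_sub_of_le h, ?_⟩
      rw [rep_sub_of_le (c := a), rep_ccwBranch_sub, rep_ccwBranch_sub]
      · ring
      · rw [rep_ccwBranch_sub, rep_ccwBranch_sub]; gcongr
    · refine Or.inr ⟨h, rep_sub_of_lt h, ?_⟩
      rw [rep_sub_of_lt (c := a), rep_ccwBranch_sub, rep_ccwBranch_sub]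
      · ring
      · rw [rep_ccwBranch_sub, rep_ccwBranch_sub]; gcongr
  have hc := rep_lt_one (c - sigma d a)
  have hc0 := rep_nonneg (c - sigma d a)
  have hp := rep_lt_one (p - sigma d a)
  have hp0 := rep_nonneg (p - sigma d a)
  have hy := rep_lt_one (y - sigma d a)
  have hy0 := rep_nonneg (y - sigma d a)
  have h1d : (1 : ℝ) ≤ d := by exact_mod_cast i.pos
  have hb : ∀ u : ℝ, -1 < u → u < 1 → -1 < u / d ∧ u / d < 1 := fun u h0 h1 =>
    ⟨by rw [lt_div_iff₀ hd]; nlinarith, by rw [div_lt_one hd]; linarith⟩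
  rcases key p with ⟨h1, h2, h3⟩ | ⟨h1, h2, h3⟩ <;> rcases key y with ⟨h4, h5, h6⟩ | ⟨h4, h5, h6⟩ <;>
    rw [h2, h3, h5, h6]
  · rw [div_lt_div_iff_of_pos_right hd]
  · refine ⟨fun _ => by linarith, fun _ => ?_⟩
    rw [div_add_one hd.ne', div_lt_div_iff_of_pos_right hd]
    linarith
  · refine ⟨fun h => absurd h ?_, fun h => absurd h (by linarith)⟩
    rw [div_add_one hd.ne', div_lt_div_iff_of_pos_right hd]
    linarith
  · rw [add_lt_add_iff_right, add_lt_add_iff_right, div_lt_div_iff_of_pos_right hd]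

theorem crosses_ccwBranch_iff {i : Fin d} {u v p q : UnitAddCircle} :
    Crosses (ccwBranch d a i u) (ccwBranch d a i v) (ccwBranch d a i p) (ccwBranch d a i q) ↔
      Crosses u v p q := by
  have h := rep_sub_lt_iff_of_sector (a := a) (i := i) (c := u) (p := u) (y := p)
  rw [sub_self, sub_self, rep_zero] at h
  rw [Crosses, Crosses, h, rep_sub_lt_iff_of_sector, rep_sub_lt_iff_of_sector]

/-- Two pairs of points that are linked lie in the same sector if each of them lies in one. -/
theorem sectorIndex_eq_of_linked {c y p q : UnitAddCircle}
    (hcy : sectorIndex d a c = sectorIndex d a y) (hpq : sectorIndex d a p = sectorIndex d a q)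
    (h1 : rep (p - c) < rep (y - c)) (h2 : rep (y - c) < rep (q - c)) :
    sectorIndex d a p = sectorIndex d a c := by
  have bound := fun z : UnitAddCircle => And.intro (rep_nonneg (z - a)) (rep_lt_one (z - a))
  rcases le_or_gt (rep (c - a)) (rep (y - a)) with h | h
  · rw [rep_sub_of_le h] at h1
    rcases le_or_gt (rep (c - a)) (rep (p - a)) with h' | h'
    · rw [rep_sub_of_le h'] at h1
      exact le_antisymm (hcy ▸ sectorIndex_mono (by linarith)) (sectorIndex_mono h')
    · rw [rep_sub_of_lt h'] at h1
      linarith [(bound p).1, (bound y).2]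
  · rw [rep_sub_of_lt h] at h2
    rcases le_or_gt (rep (c - a)) (rep (q - a)) with h' | h'
    · rw [rep_sub_of_le h'] at h2
      linarith [(bound y).1, (bound q).2]
    · rw [rep_sub_of_lt h'] at h2
      rw [hpq]
      exact le_antisymm (sectorIndex_mono h'.le) (hcy ▸ sectorIndex_mono (by linarith))

/-! ### Leaves of the pullback -/

namespace IsMajor

variable (h : IsMajor d a b)
include h

theorem pos : 0 < d := by have := h.two_le; omega

theorem cast_pos : (0 : ℝ) < d := by have := h.pos; positivity

theorem two_le_cast : (2 : ℝ) ≤ d := by exact_mod_cast h.two_le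

theorem length_pos : 0 < ccwLength a b := by
  have := h.lower; have := h.cast_pos; have := h.upper; nlinarith

theorem rep_sigma_right : rep (sigma d b - sigma d a) = d * ccwLength a b := by
  rw [← sigma_sub, rep_sigma, Int.fract_eq_self.2]
  · rfl
  · exact ⟨mul_nonneg h.cast_pos.le (rep_nonneg _), h.upper⟩

theorem eq_of_sigma_eq {p q p' q' : UnitAddCircle} (hp : (p, q) ∈ orbitLeaves d a b)
    (hp' : (p', q') ∈ orbitLeaves d a b) (he : sigma d p = sigma d p') : p = p' := by
  obtain ⟨N, hN, hNa, hNb⟩ := h.periodic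
  have key : ∀ {p q}, (p, q) ∈ orbitLeaves d a b → (sigma d)^[N] p = p := fun {p q} hp => by
    obtain ⟨k, ⟨rfl, -⟩ | ⟨rfl, -⟩⟩ := mem_orbitLeaves.1 hp <;>
      rw [← Function.iterate_add_apply, add_comm, Function.iterate_add_apply]
    · rw [hNa]
    · rw [hNb]
  exact MACLam.eq_of_sigma_eq hN (key hp) (key hp') he

theorem exists_preimage {p q : UnitAddCircle} (hpq : (p, q) ∈ orbitLeaves d a b) :
    ∃ p' q', (p', q') ∈ orbitLeaves d a b ∧ sigma d p' = p ∧ sigma d q' = q := by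
  obtain ⟨N, hN, hNa, hNb⟩ := h.periodic
  obtain ⟨k, hk⟩ := mem_orbitLeaves.1 hpq
  have key : ∀ y, (sigma d)^[N] y = y →
      sigma d ((sigma d)^[k + N - 1] y) = (sigma d)^[k] y := fun y hy => by
    rw [← Function.iterate_succ_apply' (sigma d), show (k + N - 1).succ = k + N by omega,
      Function.iterate_add_apply, hy]
  have hO := iterate_mem_orbitLeaves d a b (k + N - 1)
  rcases hk with ⟨rfl, rfl⟩ | ⟨rfl, rfl⟩
  · exact ⟨_, _, hO, key a hNa, key b hNb⟩
  · exact ⟨_, _, swap_mem_orbitLeaves hO, key b hNb, key a hNa⟩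

theorem exists_branch {p q : UnitAddCircle} (hpq : (p, q) ∈ orbitLeaves d a b) :
    ∃ i : Fin d, ccwBranch d a i (sigma d p) = p ∧ ccwBranch d a i (sigma d q) = q :=
  ⟨⟨sectorIndex d a p, sectorIndex_lt h.pos a p⟩, ccwBranch_sigma rfl,
    ccwBranch_sigma (h.sectorIndex_eq hpq).symm⟩

theorem rep_le_of_mem_orbitLeaves {p q : UnitAddCircle} (hpq : (p, q) ∈ orbitLeaves d a b) :
    rep (p - sigma d a) ≤ d * ccwLength a b := by
  obtain ⟨p', q', hpq', rfl, rfl⟩ := h.exists_preimage hpq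
  exact h.rep_sigma_le hpq'

/-- Crossing leaves that each stay in one sector share that sector. Applying `sigma d` there gives a
crossing one stage earlier. -/
theorem not_crosses_pullback {p q : UnitAddCircle} (hpq : (p, q) ∈ pullback d a b (ccwBranch d a)) :
    ∀ u v, (u, v) ∈ orbitLeaves d a b → ¬ Crosses u v p q := by
  refine pullback_induction (P := fun p q => ∀ u v, (u, v) ∈ orbitLeaves d a b → ¬ Crosses u v p q)
    (fun p q hpq u v huv => h.not_crosses huv hpq) (fun i p q hpq ih u v huv hc => ?_) hpq
  have hs := sectorIndex_eq_of_linked (h.sectorIndex_eq huv)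
    ((sectorIndex_ccwBranch i p).trans (sectorIndex_ccwBranch i q).symm) hc.2.1 hc.2.2
  rw [sectorIndex_ccwBranch] at hs
  rw [← ccwBranch_sigma hs.symm, ← ccwBranch_sigma ((h.sectorIndex_eq huv).symm.trans hs.symm),
    crosses_ccwBranch_iff] at hc
  exact ih _ _ (map_mem_orbitLeaves huv) hc

/-- By induction the image leaf is an orbit leaf. Its preimage in the orbit starts at the same
point, since `sigma d` is injective on orbit endpoints, and lies in the same sector, so it is the
given leaf. This settles leaves that merely touch the image of the major, about which the absence of
crossings says nothing. -/
theorem mem_orbitLeaves_of_mem_pullback {p q : UnitAddCircle}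
    (hpq : (p, q) ∈ pullback d a b (ccwBranch d a)) :
    ∀ q', (p, q') ∈ orbitLeaves d a b → (p, q) ∈ orbitLeaves d a b := by
  refine pullback_induction
    (P := fun p q => ∀ q', (p, q') ∈ orbitLeaves d a b → (p, q) ∈ orbitLeaves d a b)
    (fun p q hpq _ _ => hpq) (fun i p q hpq ih q' hq' => ?_) hpq
  have h1 := map_mem_orbitLeaves hq'
  rw [sigma_ccwBranch] at h1
  obtain ⟨p₁, q₁, h2, h3, h4⟩ := h.exists_preimage (ih _ h1)
  have h5 : p₁ = ccwBranch d a i p := h.eq_of_sigma_eq h2 hq' (by rw [h3, sigma_ccwBranch])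
  have h6 : sectorIndex d a q₁ = i := by
    rw [← h.sectorIndex_eq h2, h5, sectorIndex_ccwBranch]
  rwa [h5, ← ccwBranch_sigma h6, h4] at h2

/-- No leaf of the pullback crosses or leaves through the image of the major. -/
theorem rep_le_of_mem_pullback {p q : UnitAddCircle}
    (hpq : (p, q) ∈ pullback d a b (ccwBranch d a))
    (hp : rep (p - sigma d a) ≤ d * ccwLength a b) :
    rep (q - sigma d a) ≤ d * ccwLength a b := by
  have hO : (sigma d a, sigma d b) ∈ orbitLeaves d a b := iterate_mem_orbitLeaves d a b 1
  have hend : ∀ q', (p, q') ∈ orbitLeaves d a b → rep (q - sigma d a) ≤ d * ccwLength a b :=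
    fun q' hq' => h.rep_le_of_mem_orbitLeaves
      (swap_mem_orbitLeaves (h.mem_orbitLeaves_of_mem_pullback hpq q' hq'))
  by_cases h0 : p = sigma d a
  · exact hend (sigma d b) (h0 ▸ hO)
  rcases hp.eq_or_lt with hp | hp
  · rw [← h.rep_sigma_right] at hp
    have h1 : p = sigma d b := sub_left_injective (rep_injective hp)
    exact hend (sigma d a) (h1 ▸ swap_mem_orbitLeaves hO)
  · by_contra hq
    exact h.not_crosses_pullback hpq _ _ hO
      ⟨rep_sub_pos.2 h0, by rwa [h.rep_sigma_right], by rw [h.rep_sigma_right]; exact not_le.1 hq⟩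

theorem exists_branch_of_mem_pullback {p q : UnitAddCircle}
    (hpq : (p, q) ∈ pullback d a b (ccwBranch d a)) :
    (∃ i : Fin d, ccwBranch d a i (sigma d p) = p ∧ ccwBranch d a i (sigma d q) = q) ∧
      (sigma d p, sigma d q) ∈ pullback d a b (ccwBranch d a) := by
  refine pullback_induction
    (P := fun p q => (∃ i : Fin d, ccwBranch d a i (sigma d p) = p ∧
      ccwBranch d a i (sigma d q) = q) ∧ (sigma d p, sigma d q) ∈ pullback d a b (ccwBranch d a))
    (fun p q hpq => ⟨h.exists_branch hpq, orbitLeaves_subset_pullback (map_mem_orbitLeaves hpq)⟩)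
    (fun i p q hpq _ => ?_) hpq
  rw [sigma_ccwBranch, sigma_ccwBranch]
  exact ⟨⟨i, rfl, rfl⟩, hpq⟩

theorem sectorIndex_eq_of_mem_pullback {p q : UnitAddCircle}
    (hpq : (p, q) ∈ pullback d a b (ccwBranch d a)) : sectorIndex d a p = sectorIndex d a q := by
  obtain ⟨⟨i, hp, hq⟩, -⟩ := h.exists_branch_of_mem_pullback hpq
  rw [← hp, ← hq, sectorIndex_ccwBranch, sectorIndex_ccwBranch]

/-- The image leaf has both ends in the arc under the image of the major, or both outside, so its
offsets differ by at most `d l`; the branch divides this by `d`. -/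
theorem rep_sub_rep_le_of_mem_pullback {p q : UnitAddCircle}
    (hpq : (p, q) ∈ pullback d a b (ccwBranch d a)) :
    rep (p - a) - rep (q - a) ≤ ccwLength a b := by
  obtain ⟨-, h1⟩ := h.exists_branch_of_mem_pullback hpq
  have hs := h.sectorIndex_eq_of_mem_pullback hpq
  have hp := mul_rep_sub d a p
  have hq := mul_rep_sub d a q
  rw [hs] at hp
  have h2 := rep_nonneg (sigma d q - sigma d a)
  have h3 := rep_lt_one (sigma d p - sigma d a)
  have hlow := h.lower
  have hd := h.two_le_cast
  have hd0 := h.cast_pos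
  have hl := h.length_pos
  have h4 : rep (sigma d p - sigma d a) - rep (sigma d q - sigma d a) ≤ d * ccwLength a b := by
    by_cases hq1 : rep (sigma d q - sigma d a) ≤ d * ccwLength a b
    · have := h.rep_le_of_mem_pullback (swap_mem_pullback h1) hq1
      linarith
    -- Outside the arc the difference is below `1 - d l ≤ l ≤ d l`.
    · nlinarith
  have h5 : d * (rep (p - a) - rep (q - a)) ≤ d * ccwLength a b := by linarith
  exact le_of_mul_le_mul_left h5 hd0

end IsMajor

theorem norm_coe_le (r : ℝ) : ‖(r : UnitAddCircle)‖ ≤ |r| := by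
  rcases le_total |r| (1 / 2) with h | h
  · exact (norm_coe_of_abs_le h).le
  · have := AddCircle.norm_le_half_period (1 : ℝ) (x := (r : UnitAddCircle)) one_ne_zero
    rw [abs_one] at this
    exact this.trans h

theorem dist_add_coe_le (c : UnitAddCircle) (r s : ℝ) :
    dist (c + (r : UnitAddCircle)) (c + (s : UnitAddCircle)) ≤ |r - s| := by
  rw [dist_eq_norm, add_sub_add_left_eq_sub, ← AddCircle.coe_sub]
  exact norm_coe_le _

theorem dist_le_abs_rep_sub (c x y : UnitAddCircle) :
    dist x y ≤ |rep (x - c) - rep (y - c)| := by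
  have := dist_add_coe_le c (rep (x - c)) (rep (y - c))
  rwa [add_coe_rep_sub, add_coe_rep_sub] at this

namespace IsMajor

variable (h : IsMajor d a b)
include h

theorem dist_le_of_mem_pullback {p q : UnitAddCircle}
    (hpq : (p, q) ∈ pullback d a b (ccwBranch d a)) : dist p q ≤ ccwLength a b := by
  refine (dist_le_abs_rep_sub a p q).trans (abs_le.2 ⟨?_, h.rep_sub_rep_le_of_mem_pullback hpq⟩)
  linarith [h.rep_sub_rep_le_of_mem_pullback (swap_mem_pullback hpq)]

end IsMajor

/-! ### Points that are not cut off -/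

/-- The points that no leaf of the pullback separates from the clockwise side of `c`. -/
def uncut (d : ℕ) (a b c : UnitAddCircle) : Set UnitAddCircle :=
  {y | ∀ p q, (p, q) ∈ pullback d a b (ccwBranch d a) →
    ¬ (rep (p - c) < rep (y - c) ∧ rep (y - c) < rep (q - c))}

theorem self_mem_uncut (d : ℕ) (a b c : UnitAddCircle) : c ∈ uncut d a b c := fun p q _ h => by
  rw [sub_self, rep_zero] at h
  exact absurd h.1 (rep_nonneg _).not_gt

namespace IsMajor

variable (h : IsMajor d a b)
include h

theorem length_lt_half : ccwLength a b < 1 / 2 := by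
  have := h.two_le_cast; have := h.upper; have := h.length_pos; nlinarith

/-- Offsets from `a` differ by at most `l < 1/2` along a leaf, so the shorter arc of a leaf never
has `a` in its interior. Being cut off from the centre is thus betweenness in the linear order that
starts at `a`. -/
theorem trace_centralGap_eq :
    trace (centralGap (pullbackLamination d a b (ccwBranch d a))) = uncut d a b a := by
  have hl := h.length_lt_half
  have := trace_centralGap (F := pullback d a b (ccwBranch d a))
    (fun p q hpq => swap_mem_pullback hpq) hl (fun l hl => h.dist_le_of_mem_pullback hl)
  refine this.trans ?_
  ext x
  have bound := fun z : UnitAddCircle => And.intro (rep_nonneg (z - a)) (rep_lt_one (z - a))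
  constructor
  · rintro H p q hpq ⟨h1, h2⟩
    have h3 := h.rep_sub_rep_le_of_mem_pullback (swap_mem_pullback hpq)
    refine H p q hpq ?_ ?_
    · rw [ccwLength, rep_sub_of_le (c := a) (by linarith)]; linarith
    · rw [sbtw_iff_rep, rep_sub_of_le (c := a) h1.le, rep_sub_of_le (c := a) (h1.trans h2).le]
      exact ⟨by linarith, by linarith⟩
  · intro H p q hpq hlen hs
    rw [sbtw_iff_rep] at hs
    have h3 := h.rep_sub_rep_le_of_mem_pullback hpq
    have hle : rep (p - a) ≤ rep (q - a) := by
      by_contra hc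
      rw [ccwLength, rep_sub_of_lt (c := a) (not_le.1 hc)] at hlen
      linarith
    rw [rep_sub_of_le hle] at hs
    rcases le_or_gt (rep (p - a)) (rep (x - a)) with hx | hx
    · rw [rep_sub_of_le hx] at hs
      exact H p q hpq ⟨by linarith, by linarith⟩
    · rw [rep_sub_of_lt hx] at hs
      linarith [(bound q).2, (bound x).1]

/-- The central gap is the full preimage of the gap behind the image of the major: a leaf that cuts
off `x` has both ends in the sector of `x`, and leaves in a sector correspond to all leaves. -/
theorem mem_uncut_iff_sigma {x : UnitAddCircle} :
    x ∈ uncut d a b a ↔ sigma d x ∈ uncut d a b (sigma d a) := by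
  have hx := mul_rep_sub d a x
  have hd := h.cast_pos
  constructor
  · rintro H p q hpq ⟨h1, h2⟩
    let i : Fin d := ⟨sectorIndex d a x, sectorIndex_lt h.pos a x⟩
    have e : rep (x - a) = ((i : ℕ) + rep (sigma d x - sigma d a)) / d := by
      rw [← hx]; field_simp
    refine H _ _ (branch_mem_pullback i hpq) ⟨?_, ?_⟩ <;> rw [rep_ccwBranch_sub, e] <;> gcongr
  · rintro H p q hpq ⟨h1, h2⟩
    obtain ⟨-, h3⟩ := h.exists_branch_of_mem_pullback hpq
    have hs := h.sectorIndex_eq_of_mem_pullback hpq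
    have hsx : sectorIndex d a x = sectorIndex d a p :=
      le_antisymm (hs ▸ sectorIndex_mono h2.le) (sectorIndex_mono h1.le)
    have hp := mul_rep_sub d a p
    have hq := mul_rep_sub d a q
    rw [hsx] at hx
    rw [← hs] at hq
    refine H _ _ h3 ⟨?_, ?_⟩ <;> nlinarith

theorem ccwBranch_mem_uncut_iff {i : Fin d} {c y : UnitAddCircle} :
    ccwBranch d a i y ∈ uncut d a b (ccwBranch d a i c) ↔ y ∈ uncut d a b c := by
  constructor
  · rintro H p q hpq ⟨h1, h2⟩
    exact H _ _ (branch_mem_pullback i hpq)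
      ⟨rep_sub_lt_iff_of_sector.2 h1, rep_sub_lt_iff_of_sector.2 h2⟩
  · rintro H p q hpq ⟨h1, h2⟩
    have hs := h.sectorIndex_eq_of_mem_pullback hpq
    have h3 := sectorIndex_eq_of_linked
      ((sectorIndex_ccwBranch i c).trans (sectorIndex_ccwBranch i y).symm) hs h1 h2
    rw [sectorIndex_ccwBranch] at h3
    obtain ⟨-, h4⟩ := h.exists_branch_of_mem_pullback hpq
    rw [← ccwBranch_sigma h3] at h1
    rw [← ccwBranch_sigma (hs.symm.trans h3)] at h2
    exact H _ _ h4 ⟨rep_sub_lt_iff_of_sector.1 h1, rep_sub_lt_iff_of_sector.1 h2⟩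

/-- The sibling of the major above `c` is a leaf of the pullback. As `c` is not its clockwise end
`u`, the clockwise side of `c` lies under it, so it cuts off everything outside its arc. -/
theorem sectorIndex_eq_of_mem_uncut {c c' y : UnitAddCircle} (hc : (c, c') ∈ orbitLeaves d a b)
    (hca : c ≠ a) (hy : y ∈ uncut d a b c) :
    sectorIndex d a y = sectorIndex d a c ∧
      rep (sigma d y - sigma d a) ≤ d * ccwLength a b := by
  have hd := h.cast_pos
  have hO : (a, b) ∈ orbitLeaves d a b := iterate_mem_orbitLeaves d a b 0
  let i : Fin d := ⟨sectorIndex d a c, sectorIndex_lt h.pos a c⟩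
  have hleaf := branch_mem_pullback i (orbitLeaves_subset_pullback (τ := ccwBranch d a)
    (swap_mem_orbitLeaves (map_mem_orbitLeaves hO)))
  have hu := rep_ccwBranch_sub (a := a) i (sigma d a)
  have hv := rep_ccwBranch_sub (a := a) i (sigma d b)
  rw [h.rep_sigma_right] at hv
  rw [sub_self, rep_zero, add_zero] at hu
  have hcr : rep (c - a) = ((i : ℕ) + rep (sigma d c - sigma d a)) / d := by
    rw [← mul_rep_sub d a c]; field_simp
  have hc0 : 0 < rep (sigma d c - sigma d a) :=
    rep_sub_pos.2 fun he => hca (h.eq_of_sigma_eq hc hO he)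
  have hc1 := h.rep_sigma_le hc
  set u := ccwBranch d a i (sigma d a)
  set v := ccwBranch d a i (sigma d b)
  have huc : rep (u - a) < rep (c - a) := by rw [hu, hcr]; gcongr; linarith
  have hcv : rep (c - a) ≤ rep (v - a) := by rw [hv, hcr]; gcongr
  have bound := fun z : UnitAddCircle => And.intro (rep_nonneg (z - a)) (rep_lt_one (z - a))
  have huy : rep (u - a) ≤ rep (y - a) := by
    by_contra hyu
    rw [not_le] at hyu
    refine hy _ _ hleaf ⟨?_, ?_⟩
    · rw [rep_sub_of_le hcv, rep_sub_of_lt (hyu.trans huc)]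
      linarith [(bound y).1, (bound v).2]
    · rw [rep_sub_of_lt huc, rep_sub_of_lt (hyu.trans huc)]
      linarith
  have hyv : rep (y - a) ≤ rep (v - a) := by
    by_contra hvy
    rw [not_le] at hvy
    refine hy _ _ hleaf ⟨?_, ?_⟩
    · rw [rep_sub_of_le hcv, rep_sub_of_le (hcv.trans hvy.le)]
      linarith
    · rw [rep_sub_of_lt huc, rep_sub_of_le (hcv.trans hvy.le)]
      linarith [(bound y).2, (bound u).1]
  rw [hu, div_le_iff₀ hd] at huy
  rw [hv, le_div_iff₀ hd] at hyv
  obtain ⟨h1, h2⟩ := sectorIndex_eq_of (n := i) (s := d * rep (y - a) - (i : ℕ)) (d := d) (c := a)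
    (y := y) (by linarith) (by have := h.upper; linarith) (by ring)
  exact ⟨h1, by rw [h2]; linarith⟩

end IsMajor

/-! ### The return map of the central gap -/

theorem right_eq_add (a b : UnitAddCircle) : b = a + ((ccwLength a b : ℝ) : UnitAddCircle) :=
  (add_coe_rep_sub a b).symm

/-- `n` is the first time at which the major returns to itself with its orientation. -/
structure IsReturnTime (d : ℕ) (a b : UnitAddCircle) (n : ℕ) : Prop where
  pos : 0 < n
  left : (sigma d)^[n] a = a
  right : (sigma d)^[n] b = b
  left_ne : ∀ k, 0 < k → k < n → (sigma d)^[k] a ≠ a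

theorem right_mem_endcap_first (a b : UnitAddCircle) {i : Fin d} (hi : (i : ℕ) = 0) :
    b ∈ endcap d a b i := by
  have : b + (((i : ℕ) / d : ℝ) : UnitAddCircle) = b := by rw [hi]; simp
  rw [endcap, this]
  exact Set.left_mem_cIcc _ _

theorem sectorIndex_left (d : ℕ) (a : UnitAddCircle) : sectorIndex d a a = 0 := by
  simp [sectorIndex]

theorem IsReturnTime.eq_left_of_sigma_eq {n : ℕ} (hn : IsReturnTime d a b n)
    {x : UnitAddCircle} (hxn : (sigma d)^[n] x = x)
    (hx : sigma d x = sigma d a) : x = a :=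
  MACLam.eq_of_sigma_eq hn.pos hxn hn.left hx

namespace IsMajor

variable (h : IsMajor d a b)
include h

theorem exists_isReturnTime : ∃ n, IsReturnTime d a b n := by
  classical
  have hex : ∃ n, 0 < n ∧ (sigma d)^[n] a = a := by
    obtain ⟨N, hN, hNa, -⟩ := h.periodic
    exact ⟨N, hN, hNa⟩
  exact ⟨Nat.find hex, (Nat.find_spec hex).1, (Nat.find_spec hex).2,
    h.right_fixed _ (Nat.find_spec hex).2, fun k hk hkn hka => Nat.find_min hex hkn ⟨hk, hka⟩⟩

variable {n : ℕ} (hn : IsReturnTime d a b n)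
include hn

theorem sectorIndex_iterate {k : ℕ} (hk : 0 < k) (hkn : k < n) {x : UnitAddCircle}
    (hx : (sigma d)^[k] x ∈ uncut d a b ((sigma d)^[k] a)) :
    sectorIndex d a ((sigma d)^[k] x) = sectorIndex d a ((sigma d)^[k] a) ∧
      rep ((sigma d)^[k + 1] x - sigma d a) ≤ d * ccwLength a b := by
  rw [Function.iterate_succ_apply']
  exact h.sectorIndex_eq_of_mem_uncut (iterate_mem_orbitLeaves d a b k) (hn.left_ne k hk hkn) hx

/-- The first step uses the full preimage property; each later step takes place inside one sector,
where `sigma d` inverts a branch. -/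
theorem iterate_mem_uncut {x : UnitAddCircle} (hx : x ∈ uncut d a b a) :
    ∀ k, k ≤ n → (sigma d)^[k] x ∈ uncut d a b ((sigma d)^[k] a) := by
  intro k
  induction k with
  | zero => exact fun _ => hx
  | succ k ih =>
    intro hkn
    rw [Function.iterate_succ_apply', Function.iterate_succ_apply']
    have hk := ih (by omega)
    rcases k.eq_zero_or_pos with rfl | hk0
    · exact h.mem_uncut_iff_sigma.1 hx
    · have hs := (h.sectorIndex_iterate hn hk0 (by omega) hk).1
      let i : Fin d := ⟨_, sectorIndex_lt h.pos a ((sigma d)^[k] a)⟩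
      rw [← ccwBranch_sigma (i := i) hs, ← ccwBranch_sigma (i := i) (y := (sigma d)^[k] a) rfl,
        h.ccwBranch_mem_uncut_iff] at hk
      exact hk

theorem return_mem_uncut {x : UnitAddCircle} (hx : x ∈ uncut d a b a) :
    (sigma d)^[n] x ∈ uncut d a b a := by
  have := h.iterate_mem_uncut hn hx n le_rfl
  rwa [hn.left] at this

/-- The inverse branch of an iterate of `sigma d` along the orbit of the major. -/
theorem exists_inverse_branch (m : ℕ) (hm : m < n) : ∃ g : UnitAddCircle → UnitAddCircle,
    (∀ y, (sigma d)^[m] (g y) = y) ∧ g a = (sigma d)^[n - m] a ∧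
    (∀ c p y, rep (g p - g c) < rep (g y - g c) ↔ rep (p - c) < rep (y - c)) ∧
    (∀ y ∈ uncut d a b a, g y ∈ uncut d a b ((sigma d)^[n - m] a)) ∧
    ∀ x ∈ uncut d a b a, g ((sigma d)^[n] x) = (sigma d)^[n - m] x := by
  induction m with
  | zero =>
    refine ⟨id, fun _ => rfl, ?_, fun _ _ _ => Iff.rfl, ?_, fun _ _ => rfl⟩
    · exact hn.left.symm
    · rw [Nat.sub_zero, hn.left]; exact fun _ hy => hy
  | succ m ih =>
    obtain ⟨g, h1, h2, h3, h4, h5⟩ := ih (by omega)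
    obtain ⟨k, hk⟩ : ∃ k, n = m + 1 + k := ⟨n - (m + 1), by omega⟩
    have e1 : n - m = k + 1 := by omega
    have e2 : n - (m + 1) = k := by omega
    rw [e1] at h2 h4 h5
    rw [e2]
    let i : Fin d := ⟨_, sectorIndex_lt h.pos a ((sigma d)^[k] a)⟩
    have ha : ccwBranch d a i ((sigma d)^[k + 1] a) = (sigma d)^[k] a := by
      rw [Function.iterate_succ_apply']; exact ccwBranch_sigma rfl
    refine ⟨fun y => ccwBranch d a i (g y), fun y => ?_, ?_, fun c p y => ?_, fun y hy => ?_,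
      fun x hx => ?_⟩
    · rw [Function.iterate_succ_apply, sigma_ccwBranch, h1]
    · simp only [h2, ha]
    · rw [rep_sub_lt_iff_of_sector, h3]
    · rw [← ha, h.ccwBranch_mem_uncut_iff]
      exact h4 y hy
    · simp only [h5 x hx, Function.iterate_succ_apply']
      exact ccwBranch_sigma
        (h.sectorIndex_iterate hn (by omega) (by omega) (h.iterate_mem_uncut hn hx k (by omega))).1

/-- The inverse branch that leads from the central gap to the gap behind the image of the
major. -/
theorem exists_return_branch : ∃ g : UnitAddCircle → UnitAddCircle,
    (∀ i : Fin d, ∀ y, (sigma d)^[n] (ccwBranch d a i (g y)) = y) ∧ g a = sigma d a ∧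
    (∀ c p y, rep (g p - g c) < rep (g y - g c) ↔ rep (p - c) < rep (y - c)) ∧
    (∀ i : Fin d, ∀ y ∈ uncut d a b a, ccwBranch d a i (g y) ∈ uncut d a b a) ∧
    (∀ x ∈ uncut d a b a, g ((sigma d)^[n] x) = sigma d x) ∧
    (∀ y, g y = sigma d a → y = a) := by
  have hpos := hn.pos
  obtain ⟨g, h1, h2, h3, h4, h5⟩ := h.exists_inverse_branch hn (n - 1) (by omega)
  have e : n - (n - 1) = 1 := by omega
  rw [e] at h2 h4 h5
  refine ⟨g, fun i y => ?_, h2, h3, fun i y hy => ?_, h5, fun y hy => ?_⟩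
  · conv_lhs => rw [show n = (n - 1) + 1 by omega]
    rw [Function.iterate_succ_apply, sigma_ccwBranch, h1]
  · rw [h.mem_uncut_iff_sigma, sigma_ccwBranch]
    exact h4 y hy
  · rw [← h1 y, hy, ← Function.iterate_succ_apply, show (n - 1).succ = n by omega, hn.left]

theorem image_iterate_uncut : (sigma d)^[n] '' uncut d a b a = uncut d a b a := by
  obtain ⟨g, h1, -, -, h4, -⟩ := h.exists_return_branch hn
  apply Set.Subset.antisymm
  · rintro _ ⟨x, hx, rfl⟩
    exact h.return_mem_uncut hn hx
  · exact fun y hy => ⟨_, h4 ⟨0, h.pos⟩ y hy, h1 _ y⟩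

omit hn in
theorem left_add_mem_uncut (i : Fin d) : ccwBranch d a i (sigma d a) ∈ uncut d a b a := by
  rw [h.mem_uncut_iff_sigma, sigma_ccwBranch]
  exact self_mem_uncut _ _ _ _

omit hn in
-- A leaf that cuts off `sigma d b` would lead out of the arc under the image of the major.
theorem right_add_mem_uncut (i : Fin d) : ccwBranch d a i (sigma d b) ∈ uncut d a b a := by
  rw [h.mem_uncut_iff_sigma, sigma_ccwBranch]
  rintro p q hpq ⟨h1, h2⟩
  rw [h.rep_sigma_right] at h1 h2
  exact absurd (h.rep_le_of_mem_pullback hpq h1.le) (not_le.2 h2)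

/-- Before time `n` the image of the gap lies in a single sector, whereas the gap itself meets
sectors `0` and `1`. -/
theorem isLeast_return :
    IsLeast {k : ℕ | 0 < k ∧ (sigma d)^[k] '' uncut d a b a = uncut d a b a} n := by
  refine ⟨⟨hn.pos, h.image_iterate_uncut hn⟩, ?_⟩
  rintro k ⟨hk, hkK⟩
  by_contra hkn
  rw [not_le] at hkn
  have key : ∀ y ∈ uncut d a b a, sectorIndex d a y = sectorIndex d a ((sigma d)^[k] a) := by
    intro y hy
    rw [← hkK] at hy
    obtain ⟨x, hx, rfl⟩ := hy
    exact (h.sectorIndex_iterate hn hk hkn (h.iterate_mem_uncut hn hx k hkn.le)).1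
  have h0 := key _ (h.left_add_mem_uncut ⟨0, h.pos⟩)
  have h1 := key _ (h.left_add_mem_uncut ⟨1, h.two_le⟩)
  rw [sectorIndex_ccwBranch] at h0 h1
  exact absurd (h0.trans h1.symm) zero_ne_one

/-- The return map is expanding along the orbits of points of the central gap that start and
return close to each other. -/
theorem dist_return {x y : UnitAddCircle} (hx : x ∈ uncut d a b a) (hy : y ∈ uncut d a b a)
    (hxy : dist x y ≤ ccwLength a b)
    (hret : dist ((sigma d)^[n] x) ((sigma d)^[n] y) < 1 - d * ccwLength a b) :
    dist ((sigma d)^[n] x) ((sigma d)^[n] y) = d ^ n * dist x y := by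
  have hd := h.cast_pos
  have hd1 : (1 : ℝ) ≤ d := by linarith [h.two_le_cast]
  -- Between times `0` and `n` both orbits stay under a common sibling, whose length is `l`.
  have hclose : ∀ k < n, dist ((sigma d)^[k] x) ((sigma d)^[k] y) ≤ ccwLength a b := by
    intro k hkn
    rcases k.eq_zero_or_pos with rfl | hk
    · exact hxy
    · obtain ⟨h1, h2⟩ := h.sectorIndex_iterate hn hk hkn (h.iterate_mem_uncut hn hx k hkn.le)
      obtain ⟨h3, h4⟩ := h.sectorIndex_iterate hn hk hkn (h.iterate_mem_uncut hn hy k hkn.le)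
      have e1 := mul_rep_sub d a ((sigma d)^[k] x)
      have e2 := mul_rep_sub d a ((sigma d)^[k] y)
      rw [← Function.iterate_succ_apply' (sigma d)] at e1 e2
      rw [h1] at e1
      rw [h3] at e2
      have p1 := rep_nonneg ((sigma d)^[k + 1] x - sigma d a)
      have p2 := rep_nonneg ((sigma d)^[k + 1] y - sigma d a)
      refine (dist_le_abs_rep_sub a _ _).trans (abs_le.2 ⟨?_, ?_⟩)
      · refine le_of_mul_le_mul_left ?_ hd; linarith
      · refine le_of_mul_le_mul_left ?_ hd; linarith
  -- Going backwards from time `n`, the small final distance keeps every earlier one below the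
  -- threshold of `dist_sigma_eq`.
  have key : ∀ m ≤ n, d ^ m * dist ((sigma d)^[n - m] x) ((sigma d)^[n - m] y) =
      dist ((sigma d)^[n] x) ((sigma d)^[n] y) := by
    intro m
    induction m with
    | zero => intro _; simp
    | succ m ih =>
      intro hm
      have h1 := ih (by omega)
      have e : n - m = (n - (m + 1)) + 1 := by omega
      rw [e, Function.iterate_succ_apply', Function.iterate_succ_apply'] at h1
      have hpow : (1 : ℝ) ≤ d ^ m := one_le_pow₀ hd1
      have h2 : dist (sigma d ((sigma d)^[n - (m + 1)] x)) (sigma d ((sigma d)^[n - (m + 1)] y)) <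
          1 - d * ccwLength a b := by
        refine lt_of_le_of_lt ?_ hret
        rw [← h1]
        exact le_mul_of_one_le_left dist_nonneg hpow
      rw [dist_sigma_eq h.upper.le (hclose _ (by omega)) h2] at h1
      rw [← h1]; ring
  have := key n le_rfl
  rw [Nat.sub_self] at this
  exact this.symm

theorem eq_of_fixed {x y : UnitAddCircle} (hx : x ∈ uncut d a b a) (hy : y ∈ uncut d a b a)
    (hxn : (sigma d)^[n] x = x) (hyn : (sigma d)^[n] y = y)
    (hxy : dist x y < 1 - d * ccwLength a b) : x = y := by
  have h1 := h.dist_return hn hx hy (hxy.le.trans h.lower) (by rwa [hxn, hyn])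
  rw [hxn, hyn] at h1
  by_contra hne
  have h2 := dist_pos.2 hne
  have h3 : (2 : ℝ) ≤ d ^ n := h.two_le_cast.trans
    (le_self_pow₀ (by linarith [h.two_le_cast]) hn.pos.ne')
  nlinarith

/-! ### Endcaps -/

omit hn

/-- The image of the major cuts off the open arc below it. -/
theorem rep_eq_zero_or_le_of_mem_uncut {y : UnitAddCircle} (hy : y ∈ uncut d a b (sigma d a)) :
    y = sigma d a ∨ d * ccwLength a b ≤ rep (y - sigma d a) := by
  by_contra hc
  rw [not_or, not_le] at hc
  refine hy (sigma d a) (sigma d b)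
    (orbitLeaves_subset_pullback (iterate_mem_orbitLeaves d a b 1)) ⟨?_, ?_⟩
  · rw [sub_self, rep_zero]; exact rep_sub_pos.2 hc.1
  · rw [h.rep_sigma_right]; exact hc.2

theorem mem_endcap_iff {i : Fin d} {y : UnitAddCircle} : y ∈ endcap d a b i ↔
    d * rep (y - (b + (((i : ℕ) / d : ℝ) : UnitAddCircle))) ≤ 1 - d * ccwLength a b := by
  have hd := h.cast_pos
  have hl := h.length_pos
  have hup := h.upper
  have e1 : a + ((((i : ℕ) + 1) / d : ℝ) : UnitAddCircle) -
      (b + (((i : ℕ) / d : ℝ) : UnitAddCircle)) =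
      ((1 / d - ccwLength a b : ℝ) : UnitAddCircle) := by
    rw [ccwLength, AddCircle.coe_sub, coe_rep, add_div, AddCircle.coe_add]
    abel
  have hlt : ccwLength a b < 1 / d := by rw [lt_div_iff₀ hd]; linarith
  have hle : 1 / (d : ℝ) ≤ 1 / 2 := by have := h.two_le_cast; gcongr
  have e2 := congrArg rep e1
  rw [rep_coe_eq (by linarith) (by linarith)] at e2
  have hne : b + (((i : ℕ) / d : ℝ) : UnitAddCircle) ≠
      a + ((((i : ℕ) + 1) / d : ℝ) : UnitAddCircle) := by
    intro he
    rw [he, sub_self, rep_zero] at e2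
    linarith
  rw [endcap, mem_cIcc_iff_rep hne, e2, ← mul_le_mul_iff_right₀ hd, mul_sub,
    mul_one_div_cancel hd.ne']

theorem exists_of_mem_endcap {i : Fin d} {y : UnitAddCircle} (hy : y ∈ endcap d a b i) :
    ∃ e : ℝ, 0 ≤ e ∧ d * e ≤ 1 - d * ccwLength a b ∧
      y = b + (((i : ℕ) / d : ℝ) : UnitAddCircle) + (e : UnitAddCircle) ∧
      y = a + ((((i : ℕ) + (d * ccwLength a b + d * e)) / d : ℝ) : UnitAddCircle) := by
  have hd := h.cast_pos
  rw [h.mem_endcap_iff] at hy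
  have hy' := (add_coe_rep_sub (b + (((i : ℕ) / d : ℝ) : UnitAddCircle)) y).symm
  refine ⟨_, rep_nonneg _, hy, hy', hy'.trans ?_⟩
  generalize rep (y - (b + (((i : ℕ) / d : ℝ) : UnitAddCircle))) = e
  conv_lhs => rw [right_eq_add a b]
  rw [add_assoc, add_assoc, ← AddCircle.coe_add, ← AddCircle.coe_add]
  congr 2
  field_simp
  ring

theorem mem_endcap_of_eq {i : Fin d} {y : UnitAddCircle} {e : ℝ} (h0 : 0 ≤ e)
    (h1 : d * e ≤ 1 - d * ccwLength a b)
    (hy : y = b + (((i : ℕ) / d : ℝ) : UnitAddCircle) + (e : UnitAddCircle)) :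
    y ∈ endcap d a b i := by
  have he : e < 1 := by
    have := h.two_le_cast; have := h.length_pos; have := h.cast_pos; nlinarith
  rwa [h.mem_endcap_iff, hy, add_sub_cancel_left, rep_coe_eq h0 he]

/-- The exception is the counterclockwise end of the endcap, which the half-open convention assigns
to the next sector. -/
theorem sectorIndex_of_mem_endcap {i : Fin d} {y : UnitAddCircle} (hy : y ∈ endcap d a b i) :
    (sectorIndex d a y = i ∧ d * ccwLength a b ≤ rep (sigma d y - sigma d a)) ∨
      y = a + ((((i : ℕ) + 1) / d : ℝ) : UnitAddCircle) := by
  have hd := h.cast_pos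
  have hl := h.length_pos
  obtain ⟨e, he0, he1, -, hy2⟩ := h.exists_of_mem_endcap hy
  have he2 : 0 ≤ d * e := by positivity
  rcases (show d * ccwLength a b + d * e ≤ 1 by linarith).lt_or_eq with hlt | heq
  · left
    have hi : ((i : ℕ) : ℝ) + 1 ≤ d := by exact_mod_cast i.2
    have h1 : d * rep (y - a) = (i : ℕ) + (d * ccwLength a b + d * e) := by
      rw [hy2, add_sub_cancel_left, rep_coe_eq (by positivity) (by rw [div_lt_one hd]; linarith)]
      field_simp
    obtain ⟨h2, h3⟩ := sectorIndex_eq_of (by positivity) hlt h1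
    exact ⟨h2, by rw [h3]; linarith⟩
  · right
    rw [hy2, heq]

theorem mem_endcap_of_sectorIndex {i : Fin d} {y : UnitAddCircle} (hi : sectorIndex d a y = i)
    (hy : d * ccwLength a b ≤ rep (sigma d y - sigma d a)) : y ∈ endcap d a b i := by
  have hd := h.cast_pos
  have h1 := mul_rep_sub d a y
  have h2 := rep_lt_one (sigma d y - sigma d a)
  rw [hi] at h1
  set r := rep (sigma d y - sigma d a)
  refine h.mem_endcap_of_eq (e := r / d - ccwLength a b) ?_ ?_ ?_
  · rw [sub_nonneg, le_div_iff₀ hd]; linarith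
  · rw [mul_sub, mul_div_cancel₀ _ hd.ne']; linarith
  · have h3 : rep (y - a) = ((i : ℕ) + r) / d := by rw [← h1]; field_simp
    have h4 := (add_coe_rep_sub a y).symm
    rw [h3] at h4
    refine h4.trans ?_
    have hb := right_eq_add a b
    generalize ccwLength a b = l at hb ⊢
    rw [hb, add_assoc, add_assoc, ← AddCircle.coe_add, ← AddCircle.coe_add]
    congr 2
    field_simp
    ring

theorem dist_le_of_mem_endcap {i : Fin d} {x y : UnitAddCircle} (hx : x ∈ endcap d a b i)
    (hy : y ∈ endcap d a b i) : d * dist x y ≤ 1 - d * ccwLength a b := by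
  have hd := h.cast_pos
  obtain ⟨e, he0, he1, hx1, -⟩ := h.exists_of_mem_endcap hx
  obtain ⟨e', he0', he1', hy1, -⟩ := h.exists_of_mem_endcap hy
  have h1 : dist x y ≤ |e - e'| := by rw [hx1, hy1]; exact dist_add_coe_le _ _ _
  have h2 : d * dist x y ≤ |d * e - d * e'| := by
    rw [← mul_sub, abs_mul, abs_of_pos hd]; gcongr
  refine h2.trans (abs_le.2 ⟨?_, ?_⟩)
  · have : 0 ≤ d * e := by positivity
    linarith
  · have : 0 ≤ d * e' := by positivity
    linarith

/-- An endcap has length `(1 - d l)/d`, below the threshold `1 - d l` for expansion. -/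
theorem dist_lt_of_mem_endcap {i : Fin d} {x y : UnitAddCircle} (hx : x ∈ endcap d a b i)
    (hy : y ∈ endcap d a b i) : dist x y < 1 - d * ccwLength a b := by
  have h1 := h.dist_le_of_mem_endcap hx hy
  have h2 := h.two_le_cast
  have h3 := h.upper
  have h4 : 0 ≤ dist x y := dist_nonneg
  nlinarith

theorem isClosed_endcap (i : Fin d) : IsClosed (endcap d a b i) := by
  have hd := h.cast_pos
  have : endcap d a b i = (fun e : ℝ => b + (((i : ℕ) / d : ℝ) : UnitAddCircle) +
      (e : UnitAddCircle)) '' Set.Icc 0 (1 / d - ccwLength a b) := by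
    ext y
    constructor
    · intro hy
      obtain ⟨e, he0, he1, hy1, -⟩ := h.exists_of_mem_endcap hy
      refine ⟨e, ⟨he0, le_of_mul_le_mul_left ?_ hd⟩, hy1.symm⟩
      rwa [mul_sub, mul_one_div_cancel hd.ne']
    · rintro ⟨e, ⟨he0, he1⟩, rfl⟩
      refine h.mem_endcap_of_eq he0 ?_ rfl
      have : d * e ≤ d * (1 / d - ccwLength a b) := by gcongr
      rwa [mul_sub, mul_one_div_cancel hd.ne'] at this
  rw [this]
  have hc : Continuous fun e : ℝ => b + (((i : ℕ) / d : ℝ) : UnitAddCircle) + (e : UnitAddCircle) :=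
    continuous_const.add (AddCircle.continuous_mk' 1)
  exact (isCompact_Icc.image hc).isClosed

theorem left_mem_endcap_last {i : Fin d} (hi : (i : ℕ) + 1 = d) : a ∈ endcap d a b i := by
  have hd := h.cast_pos
  have hi' : ((i : ℕ) : ℝ) + 1 = d := by exact_mod_cast hi
  have : a + ((((i : ℕ) + 1) / d : ℝ) : UnitAddCircle) = a := by
    rw [hi', div_self hd.ne', AddCircle.coe_period, add_zero]
  rw [endcap, this]
  exact Set.right_mem_cIcc _ _

theorem sectorIndex_right : sectorIndex d a b = 0 := by
  have h1 : d * rep (b - a) = (0 : ℕ) + d * ccwLength a b := by simp [ccwLength]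
  exact (sectorIndex_eq_of (mul_nonneg h.cast_pos.le h.length_pos.le) h.upper h1).1

theorem sectorIndex_add_coe_succ_div {i : Fin d} (hi : (i : ℕ) + 1 < d) :
    sectorIndex d a (a + ((((i : ℕ) + 1) / d : ℝ) : UnitAddCircle)) = i + 1 := by
  have hd := h.cast_pos
  have h1 : d * rep (a + ((((i : ℕ) + 1) / d : ℝ) : UnitAddCircle) - a) = (i + 1 : ℕ) + (0 : ℝ) := by
    have : ((i : ℕ) : ℝ) + 1 < d := by exact_mod_cast hi
    rw [add_sub_cancel_left, rep_coe_eq (by positivity) (by rwa [div_lt_one hd])]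
    push_cast
    field_simp
    ring
  exact (sectorIndex_eq_of le_rfl one_pos h1).1

/-- The endpoints of the major lie in no endcap other than the first and the last. -/
theorem notMem_endcap {i : Fin d} (h0 : (i : ℕ) ≠ 0) (h1 : (i : ℕ) + 1 ≠ d) :
    a ∉ endcap d a b i ∧ b ∉ endcap d a b i := by
  have key : ∀ y, sectorIndex d a y = 0 → y ∉ endcap d a b i := fun y hy hm => by
    rcases h.sectorIndex_of_mem_endcap hm with hc | hc
    · exact h0 (hc.1.symm.trans hy)
    · rw [hc, h.sectorIndex_add_coe_succ_div (by have := i.2; omega)] at hy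
      omega
  exact ⟨key a (sectorIndex_left d a), key b h.sectorIndex_right⟩

theorem sigma_add_coe_succ_div (i : Fin d) :
    sigma d (a + ((((i : ℕ) + 1) / d : ℝ) : UnitAddCircle)) = sigma d a := by
  have := sigma_add_coe_div h.pos a (i + 1 : ℤ) 0
  simpa using this

/-! ### Fixed points of the return map -/

include hn

/-- A fixed point in the first or last endcap shares it with the fixed point `b` or `a`, and
expansion makes them equal. -/
theorem sectorIndex_of_fixed {x : UnitAddCircle} (hx : x ∈ uncut d a b a) (hxa : x ≠ a)
    (hxb : x ≠ b) (hxn : (sigma d)^[n] x = x) :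
    d * ccwLength a b ≤ rep (sigma d x - sigma d a) ∧
      sectorIndex d a x ≠ 0 ∧ sectorIndex d a x + 1 ≠ d := by
  have hr := (h.rep_eq_zero_or_le_of_mem_uncut (h.mem_uncut_iff_sigma.1 hx)).resolve_left
    fun he => hxa (hn.eq_left_of_sigma_eq hxn he)
  have hm := h.mem_endcap_of_sectorIndex (i := ⟨_, sectorIndex_lt h.pos a x⟩) rfl hr
  have haK := h.left_add_mem_uncut ⟨0, h.pos⟩
  have hbK := h.right_add_mem_uncut ⟨0, h.pos⟩
  rw [ccwBranch_sigma (sectorIndex_left d a)] at haK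
  rw [ccwBranch_sigma h.sectorIndex_right] at hbK
  refine ⟨hr, fun h0 => hxb ?_, fun h1 => hxa ?_⟩
  · exact h.eq_of_fixed hn hx hbK hxn hn.right
      (h.dist_lt_of_mem_endcap hm (right_mem_endcap_first a b h0))
  · exact h.eq_of_fixed hn hx haK hxn hn.left
      (h.dist_lt_of_mem_endcap hm (h.left_mem_endcap_last h1))

theorem mem_endcap_iff_of_fixed {x : UnitAddCircle} (hx : x ∈ uncut d a b a) (hxa : x ≠ a)
    (hxb : x ≠ b) (hxn : (sigma d)^[n] x = x) (i : Fin d) :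
    x ∈ endcap d a b i ↔ sectorIndex d a x = i := by
  refine ⟨fun hm => ?_, fun hi => h.mem_endcap_of_sectorIndex hi
    (h.sectorIndex_of_fixed hn hx hxa hxb hxn).1⟩
  rcases h.sectorIndex_of_mem_endcap hm with hc | hc
  · exact hc.1
  · exact absurd (hn.eq_left_of_sigma_eq hxn (by rw [hc, h.sigma_add_coe_succ_div])) hxa

/-- The inverse branch of the return map into sector `i` maps the part of the gap in endcap `i` into
itself and contracts it by `d ^ n ≥ 2`. -/
theorem exists_fixed (hclosed : IsClosed (uncut d a b a)) {i : Fin d} (h0 : (i : ℕ) ≠ 0)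
    (h1 : (i : ℕ) + 1 ≠ d) :
    ∃ x ∈ uncut d a b a, (sigma d)^[n] x = x ∧ x ≠ a ∧ x ≠ b ∧ sectorIndex d a x = i := by
  obtain ⟨g, g1, -, -, g4, -, g6⟩ := h.exists_return_branch hn
  obtain ⟨ha, hb⟩ := h.notMem_endcap h0 h1
  set f : UnitAddCircle → UnitAddCircle := fun y => ccwBranch d a i (g y) with hf
  set T := uncut d a b a ∩ endcap d a b i with hT
  have hmaps : Set.MapsTo f T T := by
    rintro y ⟨hy, hye⟩
    have hfy := g4 i y hy
    refine ⟨hfy, h.mem_endcap_of_sectorIndex (sectorIndex_ccwBranch i _) ?_⟩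
    -- The image can miss the endcap only at the clockwise end of the sector, which is the value of
    -- the branch at `a`; but `a` is not in this endcap.
    refine (h.rep_eq_zero_or_le_of_mem_uncut (h.mem_uncut_iff_sigma.1 hfy)).resolve_left fun he => ?_
    rw [sigma_ccwBranch] at he
    exact ha (g6 y he ▸ hye)
  have hcontr : ContractingWith (1 / 2) (hmaps.restrict f T T) := by
    refine ⟨by norm_num, LipschitzWith.of_dist_le_mul ?_⟩
    rintro ⟨y, hy⟩ ⟨z, hz⟩
    have hfd := h.dist_lt_of_mem_endcap (hmaps hy).2 (hmaps hz).2
    have := h.dist_return hn (hmaps hy).1 (hmaps hz).1 (hfd.le.trans h.lower)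
      (by rw [g1, g1]; exact h.dist_lt_of_mem_endcap hy.2 hz.2)
    rw [g1, g1] at this
    have h3 : (2 : ℝ) ≤ d ^ n := h.two_le_cast.trans
      (le_self_pow₀ (by linarith [h.two_le_cast]) hn.pos.ne')
    have h4 : 0 ≤ dist (f y) (f z) := dist_nonneg
    change dist (f y) (f z) ≤ ((1 / 2 : NNReal) : ℝ) * dist y z
    rw [this]
    push_cast
    nlinarith
  have hcomplete : IsComplete T := (hclosed.inter (h.isClosed_endcap i)).isComplete
  -- The iteration starts at `b + i/d`, the clockwise end of the endcap.
  have hmem : ccwBranch d a i (sigma d b) ∈ T := by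
    refine ⟨h.right_add_mem_uncut i, h.mem_endcap_of_sectorIndex (sectorIndex_ccwBranch i _) ?_⟩
    rw [sigma_ccwBranch, h.rep_sigma_right]
  obtain ⟨x, hxT, hfx, -⟩ := hcontr.exists_fixedPoint' hcomplete hmaps hmem (edist_ne_top _ _)
  have hfx' : ccwBranch d a i (g x) = x := hfx
  refine ⟨x, hxT.1, ?_, fun he => ha (he ▸ hxT.2), fun he => hb (he ▸ hxT.2), ?_⟩
  · have := g1 i x
    rwa [hfx'] at this
  · rw [← hfx', sectorIndex_ccwBranch]

/-- The fixed points of the return map other than the endpoints of the major correspond to the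
endcaps that are not adjacent to it. -/
theorem bijOn_sectorIndex (hclosed : IsClosed (uncut d a b a)) :
    Set.BijOn (sectorIndex d a) {x | x ∈ uncut d a b a ∧ x ≠ a ∧ x ≠ b ∧ (sigma d)^[n] x = x}
      (Set.Ico 1 (d - 1)) := by
  refine ⟨?_, ?_, ?_⟩
  · rintro x ⟨hx, hxa, hxb, hxn⟩
    have h1 := h.sectorIndex_of_fixed hn hx hxa hxb hxn
    have h2 := sectorIndex_lt h.pos a x
    exact ⟨by omega, by omega⟩
  · rintro x ⟨hx, hxa, hxb, hxn⟩ y ⟨hy, hya, hyb, hyn⟩ he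
    let i : Fin d := ⟨_, sectorIndex_lt h.pos a x⟩
    exact h.eq_of_fixed hn hx hy hxn hyn (h.dist_lt_of_mem_endcap (i := i)
      ((h.mem_endcap_iff_of_fixed hn hx hxa hxb hxn i).2 rfl)
      ((h.mem_endcap_iff_of_fixed hn hy hya hyb hyn i).2 he.symm))
  · rintro i ⟨hi0, hi1⟩
    obtain ⟨x, hx, hxn, hxa, hxb, hxi⟩ := h.exists_fixed hn hclosed (i := ⟨i, by omega⟩)
      (by simp; omega) (by simp; omega)
    exact ⟨x, ⟨hx, hxa, hxb, hxn⟩, hxi⟩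

/-- For co-roots the branch `g` agrees with `sigma d`, so its monotonicity says that `y` has the
larger offset within its sector as well as the larger index. -/
theorem lt_dist_of_sectorIndex_lt {x y : UnitAddCircle}
    (hx : x ∈ uncut d a b a ∧ x ≠ a ∧ x ≠ b ∧ (sigma d)^[n] x = x)
    (hy : y ∈ uncut d a b a ∧ y ≠ a ∧ y ≠ b ∧ (sigma d)^[n] y = y)
    (hxy : sectorIndex d a x < sectorIndex d a y) : 1 / (d : ℝ) < dist x y := by
  have hd := h.cast_pos
  obtain ⟨hx, hxa, hxb, hxn⟩ := hx
  obtain ⟨hy, hya, hyb, hyn⟩ := hy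
  obtain ⟨g, -, g2, g3, -, g5, -⟩ := h.exists_return_branch hn
  have hlt : rep (x - a) < rep (y - a) := by
    by_contra hc
    exact absurd (sectorIndex_mono (not_lt.1 hc)) (not_le.2 hxy)
  have h1 := (g3 a x y).2 hlt
  have hgx := g5 x hx
  have hgy := g5 y hy
  rw [hxn] at hgx
  rw [hyn] at hgy
  rw [g2, hgx, hgy] at h1
  have ex := mul_rep_sub d a x
  have ey := mul_rep_sub d a y
  have hi0 := (h.sectorIndex_of_fixed hn hx hxa hxb hxn).2.1
  have hj1 := (h.sectorIndex_of_fixed hn hy hya hyb hyn).2.2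
  have hj2 := sectorIndex_lt h.pos a y
  have c1 : (sectorIndex d a x : ℝ) + 1 ≤ sectorIndex d a y := by exact_mod_cast hxy
  have c2 : (1 : ℝ) ≤ sectorIndex d a x := by exact_mod_cast Nat.one_le_iff_ne_zero.2 hi0
  have c3 : (sectorIndex d a y : ℝ) + 2 ≤ d := by
    have : sectorIndex d a y + 2 ≤ d := by omega
    exact_mod_cast this
  have b1 := rep_nonneg (sigma d x - sigma d a)
  have b2 := rep_lt_one (sigma d y - sigma d a)
  have hD : dist x y = ‖((rep (y - a) - rep (x - a) : ℝ) : UnitAddCircle)‖ := by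
    rw [dist_comm, dist_eq_norm, AddCircle.coe_sub, coe_rep, coe_rep, sub_sub_sub_cancel_right]
  have habs : |rep (y - a) - rep (x - a)| = rep (y - a) - rep (x - a) :=
    abs_of_pos (by linarith)
  have hlow : 1 / (d : ℝ) < rep (y - a) - rep (x - a) := by rw [div_lt_iff₀ hd]; linarith
  -- The indices lie between `1` and `d - 2`, so the offsets differ by less than `(d - 2)/d`.
  have hhigh : 1 / (d : ℝ) < 1 - (rep (y - a) - rep (x - a)) := by rw [div_lt_iff₀ hd]; linarith
  rw [hD]
  rcases le_total (rep (y - a) - rep (x - a)) (1 / 2) with hh | hh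
  · rwa [norm_coe_of_abs_le (by rwa [habs]), habs]
  · rwa [norm_coe_of_half_le (by rwa [habs]) (by rw [habs]; linarith [one_div_pos.2 hd]), habs]

end IsMajor

/-! ### The two choices of the guiding polygon -/

namespace IsMajor

variable (h : IsMajor d a b)
include h

theorem rep_sigma_right_sub (t : UnitAddCircle) :
    (rep (t - sigma d a) ≤ d * ccwLength a b ∧
      rep (sigma d b - t) = d * ccwLength a b - rep (t - sigma d a)) ∨
    (d * ccwLength a b < rep (t - sigma d a) ∧
      rep (sigma d b - t) = d * ccwLength a b - rep (t - sigma d a) + 1) := by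
  rw [← h.rep_sigma_right]
  rcases le_or_gt (rep (t - sigma d a)) (rep (sigma d b - sigma d a)) with hc | hc
  · exact Or.inl ⟨hc, rep_sub_of_le hc⟩
  · exact Or.inr ⟨hc, rep_sub_of_lt hc⟩

/-- Substituting `b = a + l` turns branch `i` at `b` into branch `-i` modulo `d` at `a`. Beyond
`sigma d b` the offset wraps once and the index becomes `-i - 1`. -/
theorem cwBranch_eq_of_le {i j : Fin d} (hij : ∃ K : ℤ, (i : ℤ) + j = K * d) {t : UnitAddCircle}
    (ht : rep (t - sigma d a) ≤ d * ccwLength a b) :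
    cwBranch d b i t = ccwBranch d a j t := by
  have hd := h.cast_pos
  obtain ⟨K, hK⟩ := hij
  have hK' : ((i : ℕ) : ℝ) + (j : ℕ) = K * d := by exact_mod_cast hK
  have hr := ((h.rep_sigma_right_sub t).resolve_right fun hc => hc.1.not_ge ht).2
  have hb := right_eq_add a b
  rw [cwBranch, ccwBranch, hr]
  generalize ccwLength a b = l at hb ⊢
  rw [hb, add_sub_assoc, ← AddCircle.coe_sub]
  congr 1
  refine coe_eq_coe_iff.2 ⟨-K, ?_⟩
  push_cast
  field_simp
  linarith

theorem cwBranch_eq_of_lt {i j : Fin d} (hij : ∃ K : ℤ, (i : ℤ) + j + 1 = K * d)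
    {t : UnitAddCircle} (ht : d * ccwLength a b < rep (t - sigma d a)) :
    cwBranch d b i t = ccwBranch d a j t := by
  have hd := h.cast_pos
  obtain ⟨K, hK⟩ := hij
  have hK' : ((i : ℕ) : ℝ) + (j : ℕ) + 1 = K * d := by exact_mod_cast hK
  have hr := ((h.rep_sigma_right_sub t).resolve_left fun hc => hc.1.not_gt ht).2
  have hb := right_eq_add a b
  rw [cwBranch, ccwBranch, hr]
  generalize ccwLength a b = l at hb ⊢
  rw [hb, add_sub_assoc, ← AddCircle.coe_sub]
  congr 1
  refine coe_eq_coe_iff.2 ⟨-K, ?_⟩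
  push_cast
  field_simp
  linarith

omit h in
theorem exists_neg_fin (i : Fin d) : ∃ j : Fin d, ∃ K : ℤ, (i : ℤ) + j = K * d := by
  rcases Nat.eq_zero_or_pos i with hi | hi
  · exact ⟨i, 0, by simp [hi]⟩
  · exact ⟨⟨d - i, by have := i.2; omega⟩, 1, by have := i.2; simp⟩

omit h in
theorem exists_rev_fin (i : Fin d) : ∃ j : Fin d, ∃ K : ℤ, (i : ℤ) + j + 1 = K * d :=
  ⟨⟨d - 1 - i, by have := i.2; omega⟩, 1, by have := i.2; simp; omega⟩

/-- The change of index depends only on the side of the image of the major, and a pullback leaf has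
both ends on the same side. -/
theorem exists_cwBranch_eq {p q : UnitAddCircle} (hpq : (p, q) ∈ pullback d a b (ccwBranch d a))
    (i : Fin d) :
    (∃ j, cwBranch d b i p = ccwBranch d a j p ∧ cwBranch d b i q = ccwBranch d a j q) ∧
      ∃ j, cwBranch d b j p = ccwBranch d a i p ∧ cwBranch d b j q = ccwBranch d a i q := by
  have comm : ∀ {j : Fin d}, (∃ K : ℤ, (i : ℤ) + j = K * d) → ∃ K : ℤ, (j : ℤ) + i = K * d :=
    fun ⟨K, hK⟩ => ⟨K, by linarith⟩
  have comm' : ∀ {j : Fin d}, (∃ K : ℤ, (i : ℤ) + j + 1 = K * d) →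
      ∃ K : ℤ, (j : ℤ) + i + 1 = K * d := fun ⟨K, hK⟩ => ⟨K, by linarith⟩
  by_cases hp : rep (p - sigma d a) ≤ d * ccwLength a b
  · have hq := h.rep_le_of_mem_pullback hpq hp
    obtain ⟨j, hj⟩ := exists_neg_fin i
    exact ⟨⟨j, h.cwBranch_eq_of_le hj hp, h.cwBranch_eq_of_le hj hq⟩,
      ⟨j, h.cwBranch_eq_of_le (comm hj) hp, h.cwBranch_eq_of_le (comm hj) hq⟩⟩
  · have hq : ¬ rep (q - sigma d a) ≤ d * ccwLength a b := fun hq =>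
      hp (h.rep_le_of_mem_pullback (swap_mem_pullback hpq) hq)
    rw [not_le] at hp hq
    obtain ⟨j, hj⟩ := exists_rev_fin i
    exact ⟨⟨j, h.cwBranch_eq_of_lt hj hp, h.cwBranch_eq_of_lt hj hq⟩,
      ⟨j, h.cwBranch_eq_of_lt (comm' hj) hp, h.cwBranch_eq_of_lt (comm' hj) hq⟩⟩

/-- The two guiding polygons at the endpoints of the major produce the same leaves. -/
theorem pullbackStage_cwBranch (n : ℕ) :
    pullbackStage d a b (cwBranch d b) n = pullbackStage d a b (ccwBranch d a) n := by
  induction n with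
  | zero => rfl
  | succ n ih =>
    have hsub : pullbackStage d a b (ccwBranch d a) n ⊆ pullback d a b (ccwBranch d a) :=
      Set.subset_iUnion (pullbackStage d a b (ccwBranch d a)) n
    rw [pullbackStage, pullbackStage, ih]
    congr 1
    apply Set.Subset.antisymm
    · refine Set.iUnion_subset fun i => ?_
      rintro _ ⟨⟨p, q⟩, hl, rfl⟩
      obtain ⟨⟨j, hp, hq⟩, -⟩ := h.exists_cwBranch_eq (hsub hl) i
      exact Set.mem_iUnion.2 ⟨j, (p, q), hl, Prod.ext hp.symm hq.symm⟩
    · refine Set.iUnion_subset fun i => ?_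
      rintro _ ⟨⟨p, q⟩, hl, rfl⟩
      obtain ⟨-, j, hp, hq⟩ := h.exists_cwBranch_eq (hsub hl) i
      exact Set.mem_iUnion.2 ⟨j, (p, q), hl, Prod.ext hp hq⟩

theorem pullbackLamination_cwBranch :
    pullbackLamination d a b (cwBranch d b) = pullbackLamination d a b (ccwBranch d a) := by
  rw [pullbackLamination, pullbackLamination]
  simp_rw [h.pullbackStage_cwBranch]

/-! ### The co-roots -/

variable {n : ℕ} (hn : IsReturnTime d a b n)
include hn

theorem isFirstReturnTime : IsFirstReturnTime d
    (centralGap (pullbackLamination d a b (ccwBranch d a))) n := by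
  rw [IsFirstReturnTime, h.trace_centralGap_eq]
  exact h.isLeast_return hn

theorem coRoots_eq : coRoots d a b (centralGap (pullbackLamination d a b (ccwBranch d a))) =
    {x | x ∈ uncut d a b a ∧ x ≠ a ∧ x ≠ b ∧ (sigma d)^[n] x = x} := by
  have hfr := h.isFirstReturnTime hn
  ext x
  rw [coRoots, Set.mem_ofPred, pt_mem_frontier_centralGap, h.trace_centralGap_eq]
  constructor
  · rintro ⟨hx, hxa, hxb, m, hm, hxm⟩
    rw [IsLeast.unique hm hfr] at hxm
    exact ⟨hx, hxa, hxb, hxm⟩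
  · rintro ⟨hx, hxa, hxb, hxn⟩
    exact ⟨hx, hxa, hxb, n, hfr, hxn⟩

end IsMajor

end MACLam

/-! ### The Co-root Theorem -/

theorem mainTheorem4 (d : ℕ) (hd : 2 ≤ d) (a b : UnitAddCircle)
    (hM : MACLam.IsMACLeaf d a b)
    -- the endpoints are named so that the short arc runs counterclockwise from `a` to `b`
    (hab : MACLam.ccwLength a b < 1 / 2)
    -- the guiding all critical polygon is attached to `a` or to `b`
    (τ : Fin d → UnitAddCircle → UnitAddCircle)
    (hτ : τ = MACLam.ccwBranch d a ∨ τ = MACLam.cwBranch d b)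
    (G : Set ℂ) (hG : G = MACLam.centralGap (MACLam.pullbackLamination d a b τ)) :
    -- the central gap returns to itself
    (∃ n, MACLam.IsFirstReturnTime d G n) ∧
    -- there are exactly `d - 2` co-roots
    (MACLam.coRoots d a b G).encard = ((d - 2 : ℕ) : ℕ∞) ∧
    -- each of them lies in an endcap that is not adjacent to the major
    (∀ c ∈ MACLam.coRoots d a b G, ∃ i : Fin d, c ∈ MACLam.endcap d a b i ∧
      a ∉ MACLam.endcap d a b i ∧ b ∉ MACLam.endcap d a b i) ∧
    -- distinct co-roots lie in different endcaps, and more than `1 / d` apart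
    (∀ c ∈ MACLam.coRoots d a b G, ∀ c' ∈ MACLam.coRoots d a b G, c ≠ c' →
      (∀ i : Fin d, c ∈ MACLam.endcap d a b i → c' ∉ MACLam.endcap d a b i) ∧
      1 / (d : ℝ) < dist c c') := by
  have h := hM.isMajor hd hab
  have hG' : G = MACLam.centralGap (MACLam.pullbackLamination d a b (MACLam.ccwBranch d a)) := by
    rcases hτ with rfl | rfl
    · exact hG
    · rw [hG, h.pullbackLamination_cwBranch]
  obtain ⟨n, hn⟩ := h.exists_isReturnTime
  -- Closedness, which the contraction principle requires, comes from the gap being a closure.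
  have hclosed : IsClosed (MACLam.uncut d a b a) := by
    rw [← h.trace_centralGap_eq]
    exact MACLam.isClosed_trace_centralGap _
  have hbij := h.bijOn_sectorIndex hn hclosed
  rw [hG', h.coRoots_eq hn]
  refine ⟨⟨n, h.isFirstReturnTime hn⟩, ?_, ?_, ?_⟩
  · rw [← hbij.injOn.encard_image, hbij.image_eq, ← Finset.coe_Ico, Set.encard_coe_eq_coe_finsetCard,
      Nat.card_Ico]
    rfl
  · rintro c ⟨hc, hca, hcb, hcn⟩
    let i : Fin d := ⟨_, MACLam.sectorIndex_lt h.pos a c⟩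
    have hi := h.sectorIndex_of_fixed hn hc hca hcb hcn
    exact ⟨i, (h.mem_endcap_iff_of_fixed hn hc hca hcb hcn i).2 rfl, h.notMem_endcap hi.2.1 hi.2.2⟩
  · intro c hc c' hc' hne
    have hidx : MACLam.sectorIndex d a c ≠ MACLam.sectorIndex d a c' := fun he =>
      hne (hbij.injOn hc hc' he)
    refine ⟨fun i hi hi' => hidx ?_, ?_⟩
    · rw [h.mem_endcap_iff_of_fixed hn hc.1 hc.2.1 hc.2.2.1 hc.2.2.2] at hi
      rw [h.mem_endcap_iff_of_fixed hn hc'.1 hc'.2.1 hc'.2.2.1 hc'.2.2.2] at hi'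
      exact hi.trans hi'.symm
    · rcases hidx.lt_or_gt with hlt | hlt
      · exact h.lt_dist_of_sectorIndex_lt hn hc hc' hlt
      · rw [dist_comm]
        exact h.lt_dist_of_sectorIndex_lt hn hc' hc hlt
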